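/- Let $k$ be a field. For a commutative $k$-algebra $A$ let $A^\circ$ be its finite dual coalgebra: the space of linear functionals $A\to k$ that vanish on an ideal of finite codimension, with comultiplication the restriction $A^\circ\to A^\circ\otimes A^\circ$ of the transpose of the multiplication of $A$ and counit $\varphi\mapsto\varphi(1)$. For a $k$-scheme $X$ let $$\operatorname{Dist}(X)=\varinjlim_{S}\Gamma(S,\mathcal O_S)^*$$ be the direct limit of dual coalgebras over the closed subschemes $S\subseteq X$ that are finite over $k$. It is a functor of $X$: a morphism $f\colon X\to Y$ of $k$-schemes maps $\Gamma(S,\mathcal O_S)^*$ to $\Gamma(S',\mathcal O_{S'})^*$, where $S'$ is the scheme-theoretic image of $S$ in $Y$ (which is again finite over $k$), by the transpose of $\Gamma(S',\mathcal O_{S'})\to\Gamma(S,\mathcal O_S)$. For $x\in X$ put $\operatorname{Dist}(X,x)=(\mathcal O_{X,x})^\circ$. Let $X_0$ be the set of closed points of $X$ and $\operatorname{fin}(X)=\{x\in X\mid[\kappa(x):k]<\infty\}$. For each $x\in X$ the canonical morphism $\operatorname{Spec}\mathcal O_{X,x}\to X$ induces a coalgebra homomorphism $\operatorname{Dist}(X,x)=(\mathcal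 O_{X,x})^\circ\cong\operatorname{Dist}(\operatorname{Spec}\mathcal O_{X,x})\to\operatorname{Dist}(X)$, where the isomorphism is the canonical one, under which $\varphi\in\Gamma(S,\mathcal O_S)^*$ corresponds to the composite $\mathcal O_{X,x}\to\Gamma(S,\mathcal O_S)\xrightarrow{\varphi}k$. Then, for every $k$-scheme $X$: 1. The homomorphisms above induce an isomorphism of coalgebras $$\bigoplus_{x\in\operatorname{fin}(X)}\operatorname{Dist}(X,x)=\bigoplus_{x\in\operatorname{fin}(X)}(\mathcal O_{X,x})^\circ\;\cong\;\operatorname{Dist}(X).$$ 2. This isomorphism is natural in $X$: for a morphism $f\colon X\to Y$ of $k$-schemes it commutes with $\operatorname{Dist}(f)$ and with the homomorphism $\bigoplus_{x\in\operatorname{fin}(X)}(\mathcal O_{X,x})^\circ\to\bigoplus_{y\in\operatorname{fin}(Y)}(\mathcal O_{Y,y})^\circ$ whose components are the duals $(\mathcal O_{X,x})^\circ\to(\mathcal O_{Y,f(x)})^\circ$ of the homomorphisms $\mathcal O_{Y,f(x)}\to\mathcal O_{X,x}$. 3. One has $\operatorname{fin}(X)\subseteq X_0$ and $(\mathcal O_{X,x})^\circ=0$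 for $x\notin\operatorname{fin}(X)$, and the homomorphisms above also induce an isomorphism of coalgebras from Takeuchi's underlying coalgebra $\bigoplus_{x\in X_0}\operatorname{Dist}(X,x)$ to $\operatorname{Dist}(X)$. -/

import Mathlib

open CategoryTheory AlgebraicGeometry TensorProduct

universe u

namespace SchemeDist

noncomputable section LinearAlgebra

variable {k : Type*} [Field k]

/-- The product functional `f ⊗ g : D ⊗ E → k`, `d ⊗ e ↦ f d * g e`. -/
def evT {D E : Type*} [AddCommMonoid D] [Module k D] [AddCommMonoid E] [Module k E]
    (f : D →ₗ[k] k) (g : E →ₗ[k] k) : D ⊗[k] E →ₗ[k] k :=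
  LinearMap.mul' k k ∘ₗ TensorProduct.map f g

theorem evT_tmul {D E : Type*} [AddCommMonoid D] [Module k D] [AddCommMonoid E] [Module k E]
    (f : D →ₗ[k] k) (g : E →ₗ[k] k) (d : D) (e : E) : evT f g (d ⊗ₜ e) = f d * g e := by
  simp [evT]

theorem evT_comp_map {D E D' E' : Type*} [AddCommMonoid D] [Module k D] [AddCommMonoid E]
    [Module k E] [AddCommMonoid D'] [Module k D'] [AddCommMonoid E'] [Module k E']
    (f : D →ₗ[k] k) (g : E →ₗ[k] k) (p : D' →ₗ[k] D) (q : E' →ₗ[k] E) (t : D' ⊗[k] E') :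
    evT f g (TensorProduct.map p q t) = evT (f ∘ₗ p) (g ∘ₗ q) t := by
  simp only [evT, LinearMap.comp_apply, TensorProduct.map_comp]

/-- Product functionals of two separating families separate the points of the tensor product. -/
theorem evT_separates {D E : Type*} [AddCommGroup D] [Module k D] [AddCommGroup E] [Module k E]
    {ι κ : Type*} (f : ι → D →ₗ[k] k) (g : κ → E →ₗ[k] k)
    (hf : ∀ d, (∀ i, f i d = 0) → d = 0) (hg : ∀ e, (∀ j, g j e = 0) → e = 0)
    (t : D ⊗[k] E) (ht : ∀ i j, evT (f i) (g j) t = 0) : t = 0 := by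
  classical
  let b := Module.Basis.ofVectorSpace k D
  obtain ⟨c, rfl⟩ := (TensorProduct.equivFinsuppOfBasisLeft (N := E) b).symm.surjective t
  suffices h : c = 0 by simp [h]
  ext x
  refine hg _ fun j => ?_
  have key : ∑ y ∈ c.support, g j (c y) • b y = 0 := by
    refine hf _ fun i => ?_
    have := ht i j
    rw [TensorProduct.equivFinsuppOfBasisLeft_symm_apply, Finsupp.sum, map_sum] at this
    rw [map_sum, ← this]
    refine Finset.sum_congr rfl fun y _ => ?_
    rw [evT_tmul, map_smul, smul_eq_mul, mul_comm]
  by_cases hx : x ∈ c.support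
  · exact linearIndependent_iff'.mp b.linearIndependent _ _ key x hx
  · simp [Finsupp.notMem_support_iff.mp hx]

theorem evT_ext {D E : Type*} [AddCommGroup D] [Module k D] [AddCommGroup E] [Module k E]
    {ι κ : Type*} (f : ι → D →ₗ[k] k) (g : κ → E →ₗ[k] k)
    (hf : ∀ d, (∀ i, f i d = 0) → d = 0) (hg : ∀ e, (∀ j, g j e = 0) → e = 0)
    {s t : D ⊗[k] E} (ht : ∀ i j, evT (f i) (g j) s = evT (f i) (g j) t) : s = t :=
  sub_eq_zero.mp <| evT_separates f g hf hg _ fun i j => by rw [map_sub, ht, sub_self]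

/-- Let the space `D` be separated by functionals `ev a` indexed by an algebra `A`. A
comultiplication with `(ev a ⊗ ev b) ∘ Δ = ev (a * b)` together with the counit `ev 1` is
coassociative and counital. -/
@[reducible] def coalgebraOfEv {A D : Type*} [Monoid A] [AddCommGroup D] [Module k D]
    [CoalgebraStruct k D] (ev : A → D →ₗ[k] k) (hev : ∀ d, (∀ a, ev a d = 0) → d = 0)
    (hΔ : ∀ a b d, evT (ev a) (ev b) (CoalgebraStruct.comul (R := k) d) = ev (a * b) d)
    (hε : CoalgebraStruct.counit (R := k) = ev 1) :
    Coalgebra k D where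
  coassoc := by
    ext d
    refine evT_ext ev (fun p : A × A => evT (ev p.1) (ev p.2)) hev
      (fun t ht => evT_separates ev ev hev hev t fun i j => ht (i, j)) fun a p => ?_
    have h1 : evT (ev a) (evT (ev p.1) (ev p.2)) ∘ₗ (TensorProduct.assoc k D D D).toLinearMap
        = evT (evT (ev a) (ev p.1)) (ev p.2) := by
      ext x y z; simp [evT, mul_assoc]
    have h2 := LinearMap.congr_fun h1 (CoalgebraStruct.comul.rTensor D (CoalgebraStruct.comul (R := k) d))
    have h3 : evT (ev a) (ev p.1) ∘ₗ CoalgebraStruct.comul = ev (a * p.1) := LinearMap.ext (hΔ _ _)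
    have h4 : evT (ev p.1) (ev p.2) ∘ₗ CoalgebraStruct.comul = ev (p.1 * p.2) := LinearMap.ext (hΔ _ _)
    simp only [LinearMap.comp_apply, LinearEquiv.coe_coe] at h2 ⊢
    rw [h2, LinearMap.rTensor, evT_comp_map, LinearMap.lTensor, evT_comp_map, h3, h4,
      LinearMap.comp_id, LinearMap.comp_id, hΔ, hΔ, mul_assoc]
  rTensor_counit_comp_comul := by
    ext d
    refine evT_ext (fun _ : Unit => LinearMap.id) ev (fun d hd => hd ()) hev fun _ a => ?_
    rw [LinearMap.comp_apply, LinearMap.rTensor, evT_comp_map, hε, LinearMap.id_comp,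
      LinearMap.comp_id, hΔ, one_mul, TensorProduct.mk_apply, evT_tmul]
    simp
  lTensor_counit_comp_comul := by
    ext d
    refine evT_ext ev (fun _ : Unit => LinearMap.id) hev (fun d hd => hd ()) fun a _ => ?_
    rw [LinearMap.comp_apply, LinearMap.lTensor, evT_comp_map, hε, LinearMap.id_comp,
      LinearMap.comp_id, hΔ, mul_one, LinearMap.flip_apply, TensorProduct.mk_apply, evT_tmul]
    simp

end LinearAlgebra

noncomputable section Duals

variable {k : Type*} [Field k]

section DualCoalgebra

variable {A : Type*} [CommRing A] [Algebra k A]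

theorem dual_separates (d : Module.Dual k A) (h : ∀ a, Module.Dual.eval k A a d = 0) : d = 0 :=
  LinearMap.ext h

/-- The dual coalgebra `A^*` of a finite-dimensional algebra: the comultiplication is the
transpose of the multiplication, followed by `(A ⊗ A)^* ≅ A^* ⊗ A^*`; the counit is `φ ↦ φ 1`. -/
instance dualCoalgebraStruct [Module.Finite k A] : CoalgebraStruct k (Module.Dual k A) where
  comul := (dualDistribEquiv k A A).symm.toLinearMap ∘ₗ (LinearMap.mul' k A).dualMap
  counit := Module.Dual.eval k A 1

theorem evT_comul_dual [Module.Finite k A] (a b : A) (φ : Module.Dual k A) :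
    evT (Module.Dual.eval k A a) (Module.Dual.eval k A b) (CoalgebraStruct.comul (R := k) φ)
      = φ (a * b) := by
  have h : evT (Module.Dual.eval k A a) (Module.Dual.eval k A b)
      = Module.Dual.eval k _ (a ⊗ₜ[k] b) ∘ₗ (dualDistribEquiv k A A).toLinearMap := by
    ext f g; simp [evT, dualDistribEquiv, dualDistribEquivOfBasis]
  rw [h]
  have := (dualDistribEquiv k A A).apply_symm_apply ((LinearMap.mul' k A).dualMap φ)
  exact (LinearMap.congr_fun this (a ⊗ₜ b)).trans (by simp)

instance dualCoalgebra [Module.Finite k A] : Coalgebra k (Module.Dual k A) :=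
  coalgebraOfEv (fun a : A => Module.Dual.eval k A a) dual_separates evT_comul_dual rfl

/-- The transpose of an algebra homomorphism, as a homomorphism of dual coalgebras. -/
def dualMap {B : Type*} [CommRing B] [Algebra k B] [Module.Finite k A] [Module.Finite k B]
    (f : A →ₐ[k] B) : Module.Dual k B →ₗc[k] Module.Dual k A where
  toLinearMap := f.toLinearMap.dualMap
  counit_comp := by
    ext φ
    simp [CoalgebraStruct.counit]
  map_comp_comul := by
    refine LinearMap.ext fun φ => ?_
    refine evT_ext (fun a : A => Module.Dual.eval k A a) (fun a : A => Module.Dual.eval k A a)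
      dual_separates dual_separates fun a b => ?_
    rw [LinearMap.comp_apply, LinearMap.comp_apply, evT_comul_dual, evT_comp_map]
    refine (evT_comul_dual (f a) (f b) φ).trans ?_
    simp

end DualCoalgebra

section FiniteDual

variable (k) in
/-- The finite dual `A°` as a subspace of `A^*`: the functionals that vanish on an ideal of
finite codimension. -/
def finiteDualSubmodule (A : Type*) [CommRing A] [Algebra k A] : Submodule k (Module.Dual k A) where
  carrier := {φ | ∃ I : Ideal A, Module.Finite k (A ⧸ I) ∧ ∀ a ∈ I, φ a = 0}
  zero_mem' := ⟨⊤, inferInstance, fun _ _ => rfl⟩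
  smul_mem' := by
    rintro c φ ⟨I, hI, h⟩
    exact ⟨I, hI, fun a ha => by simp [h a ha]⟩
  add_mem' := by
    rintro φ ψ ⟨I, hI, h⟩ ⟨J, hJ, h'⟩
    refine ⟨I ⊓ J, ?_, fun a ha => by simp [h a ha.1, h' a ha.2]⟩
    let g : A →ₐ[k] (A ⧸ I) × (A ⧸ J) :=
      (Ideal.Quotient.mkₐ k I).prod (Ideal.Quotient.mkₐ k J)
    have hg : ∀ a, g a = 0 ↔ a ∈ I ⊓ J := fun a => by
      simp [g, Prod.ext_iff, Ideal.Quotient.eq_zero_iff_mem]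
    refine Module.Finite.of_injective
      (Ideal.Quotient.liftₐ (I ⊓ J) g fun a ha => (hg a).mpr ha).toLinearMap ?_
    refine (injective_iff_map_eq_zero
      (Ideal.Quotient.liftₐ (I ⊓ J) g fun a ha => (hg a).mpr ha)).mpr fun x hx => ?_
    obtain ⟨a, rfl⟩ := Ideal.Quotient.mk_surjective x
    exact Ideal.Quotient.eq_zero_iff_mem.mpr ((hg a).mp hx)

variable (k) in
/-- The finite dual `A°` of a commutative `k`-algebra `A`. -/
def FiniteDual (A : Type*) [CommRing A] [Algebra k A] : Type _ := finiteDualSubmodule k A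

variable {A : Type*} [CommRing A] [Algebra k A]

instance : AddCommGroup (FiniteDual k A) := inferInstanceAs (AddCommGroup (finiteDualSubmodule k A))

instance : Module k (FiniteDual k A) := inferInstanceAs (Module k (finiteDualSubmodule k A))

variable (k A) in
/-- The inclusion `A° → A^*`. -/
def FiniteDual.incl : FiniteDual k A →ₗ[k] Module.Dual k A := (finiteDualSubmodule k A).subtype

/-- A linear map to `A^*` with image in `A°`, as a map to `A°`. -/
def FiniteDual.codRestrict {V : Type*} [AddCommGroup V] [Module k V] (f : V →ₗ[k] Module.Dual k A)
    (hf : ∀ v, f v ∈ finiteDualSubmodule k A) : V →ₗ[k] FiniteDual k A :=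
  LinearMap.codRestrict (finiteDualSubmodule k A) f hf

theorem FiniteDual.incl_mem (φ : FiniteDual k A) :
    FiniteDual.incl k A φ ∈ finiteDualSubmodule k A := φ.2

theorem FiniteDual.incl_injective : Function.Injective (FiniteDual.incl k A) :=
  Subtype.val_injective

/-- Evaluation at `a`, as a functional on the finite dual. -/
def FiniteDual.ev (a : A) : FiniteDual k A →ₗ[k] k :=
  Module.Dual.eval k A a ∘ₗ FiniteDual.incl k A

theorem FiniteDual.ev_apply (a : A) (φ : FiniteDual k A) :
    FiniteDual.ev a φ = FiniteDual.incl k A φ a := rfl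

theorem FiniteDual.separates (d : FiniteDual k A) (h : ∀ a : A, FiniteDual.ev a d = 0) : d = 0 :=
  FiniteDual.incl_injective (LinearMap.ext h)

theorem FiniteDual.tensor_ext {s t : FiniteDual k A ⊗[k] FiniteDual k A}
    (h : ∀ a b : A, evT (FiniteDual.ev a) (FiniteDual.ev b) s
      = evT (FiniteDual.ev a) (FiniteDual.ev b) t) : s = t :=
  evT_ext (D := FiniteDual k A) (E := FiniteDual k A) (fun a : A => FiniteDual.ev a)
    (fun a : A => FiniteDual.ev a) FiniteDual.separates FiniteDual.separates h

variable (k A) in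
/-- The natural map `A° ⊗ A° → (A ⊗ A)^*`. -/
def FiniteDual.distrib : FiniteDual k A ⊗[k] FiniteDual k A →ₗ[k] Module.Dual k (A ⊗[k] A) :=
  dualDistrib k A A ∘ₗ TensorProduct.map (FiniteDual.incl k A) (FiniteDual.incl k A)

theorem FiniteDual.distrib_apply (t : FiniteDual k A ⊗[k] FiniteDual k A) (a b : A) :
    FiniteDual.distrib k A t (a ⊗ₜ b) = evT (FiniteDual.ev a) (FiniteDual.ev b) t := by
  have h : Module.Dual.eval k _ (a ⊗ₜ[k] b) ∘ₗ FiniteDual.distrib k A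
      = evT (FiniteDual.ev a) (FiniteDual.ev b) := by
    ext f g; simp [evT, FiniteDual.distrib, FiniteDual.ev]
  exact LinearMap.congr_fun h t

theorem FiniteDual.distrib_injective : Function.Injective (FiniteDual.distrib k A) := by
  intro s t h
  refine FiniteDual.tensor_ext fun a b => ?_
  rw [← FiniteDual.distrib_apply, h, FiniteDual.distrib_apply]

theorem comp_mem_finiteDual {B : Type*} [CommRing B] [Algebra k B] (f : A →ₐ[k] B)
    (φ : Module.Dual k B) (hφ : φ ∈ finiteDualSubmodule k B) :
    φ ∘ₗ f.toLinearMap ∈ finiteDualSubmodule k A := by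
  obtain ⟨I, hI, h⟩ := hφ
  refine ⟨I.comap f, ?_, fun a ha => h _ ha⟩
  exact Module.Finite.of_injective (Ideal.quotientMapₐ I f le_rfl).toLinearMap
    (Ideal.quotientMap_injective (f := (f : A →+* B)))

theorem mem_finiteDual_of_finite [Module.Finite k A] (φ : Module.Dual k A) :
    φ ∈ finiteDualSubmodule k A :=
  ⟨⊥, inferInstance, fun a ha => by rw [Ideal.mem_bot.mp ha, map_zero]⟩

/-- The transpose `m^*` of the multiplication maps `A°` into `A° ⊗ A°`. -/
theorem FiniteDual.mul_mem_range (φ : FiniteDual k A) :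
    (LinearMap.mul' k A).dualMap (FiniteDual.incl k A φ) ∈ LinearMap.range (FiniteDual.distrib k A) := by
  obtain ⟨I, hI, h⟩ := φ.incl_mem
  rw [LinearMap.mem_range]
  let ψ : Module.Dual k (A ⧸ I) := (I.restrictScalars k).liftQ (FiniteDual.incl k A φ) (fun a ha => h a ha)
  let q : Module.Dual k (A ⧸ I) →ₗ[k] FiniteDual k A :=
    FiniteDual.codRestrict (Ideal.Quotient.mkₐ k I).toLinearMap.dualMap fun χ =>
      comp_mem_finiteDual (Ideal.Quotient.mkₐ k I) χ (mem_finiteDual_of_finite χ)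
  refine ⟨TensorProduct.map q q (CoalgebraStruct.comul (R := k) ψ), ?_⟩
  ext a b
  refine (FiniteDual.distrib_apply _ a b).trans ?_
  rw [evT_comp_map]
  exact evT_comul_dual (Ideal.Quotient.mk I a) (Ideal.Quotient.mk I b) ψ

/-- The comultiplication of `A°` is the unique map `Δ : A° → A° ⊗ A°` whose composite with the
natural injection `A° ⊗ A° → (A ⊗ A)^*` is the transpose of the multiplication; the counit is
`φ ↦ φ 1`. -/
instance FiniteDual.coalgebraStruct : CoalgebraStruct k (FiniteDual k A) where
  comul := (LinearEquiv.ofInjective _ FiniteDual.distrib_injective).symm.toLinearMap ∘ₗ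
    ((LinearMap.mul' k A).dualMap ∘ₗ FiniteDual.incl k A).codRestrict
      (LinearMap.range (FiniteDual.distrib k A)) FiniteDual.mul_mem_range
  counit := FiniteDual.ev 1

theorem FiniteDual.evT_comul (a b : A) (φ : FiniteDual k A) :
    evT (FiniteDual.ev a) (FiniteDual.ev b) (CoalgebraStruct.comul (R := k) φ)
      = FiniteDual.ev (a * b) φ := by
  rw [← FiniteDual.distrib_apply]
  have := LinearEquiv.ofInjective_symm_apply (f := FiniteDual.distrib k A) (h := FiniteDual.distrib_injective)
    (((LinearMap.mul' k A).dualMap ∘ₗ FiniteDual.incl k A).codRestrict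
      (LinearMap.range (FiniteDual.distrib k A)) FiniteDual.mul_mem_range φ)
  exact (LinearMap.congr_fun this (a ⊗ₜ b)).trans (by simp [FiniteDual.ev])

instance FiniteDual.coalgebra : Coalgebra k (FiniteDual k A) :=
  coalgebraOfEv (fun a : A => FiniteDual.ev a) FiniteDual.separates FiniteDual.evT_comul rfl

/-- An algebra homomorphism `f : A → B` induces the coalgebra homomorphism `B° → A°`,
`φ ↦ φ ∘ f`. -/
def FiniteDual.map {B : Type*} [CommRing B] [Algebra k B] (f : A →ₐ[k] B) :
    FiniteDual k B →ₗc[k] FiniteDual k A where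
  toLinearMap := FiniteDual.codRestrict (f.toLinearMap.dualMap ∘ₗ FiniteDual.incl k B)
    fun φ => comp_mem_finiteDual f _ φ.incl_mem
  counit_comp := by
    ext φ
    exact congrArg (FiniteDual.incl k B φ) (map_one f)
  map_comp_comul := by
    refine LinearMap.ext fun φ => ?_
    refine FiniteDual.tensor_ext fun a b => ?_
    rw [LinearMap.comp_apply, LinearMap.comp_apply, FiniteDual.evT_comul, evT_comp_map]
    refine (FiniteDual.evT_comul (f a) (f b) φ).trans ?_
    exact congrArg (FiniteDual.incl k B φ) (map_mul f a b).symm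

/-- For a homomorphism `f : A → B` to a finite-dimensional algebra, the coalgebra homomorphism
`B^* → A°`, `φ ↦ φ ∘ f`. -/
def FiniteDual.ofDual {B : Type*} [CommRing B] [Algebra k B] [Module.Finite k B] (f : A →ₐ[k] B) :
    Module.Dual k B →ₗc[k] FiniteDual k A where
  toLinearMap := FiniteDual.codRestrict f.toLinearMap.dualMap
    fun φ => comp_mem_finiteDual f φ (mem_finiteDual_of_finite φ)
  counit_comp := by
    ext φ
    exact congrArg φ (map_one f)
  map_comp_comul := by
    refine LinearMap.ext fun φ => ?_
    refine FiniteDual.tensor_ext fun a b => ?_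
    rw [LinearMap.comp_apply, LinearMap.comp_apply, FiniteDual.evT_comul, evT_comp_map]
    refine (evT_comul_dual (f a) (f b) φ).trans ?_
    exact congrArg φ (map_mul f a b).symm

end FiniteDual

end Duals

noncomputable section DirectLimit

open scoped Classical in
/-- The direct limit of a system of coalgebras `G i` and coalgebra homomorphisms `f i j`: the
direct limit of the underlying vector spaces. -/
def CoalgLimit {k : Type*} [Field k] {ι : Type*} [Preorder ι] {G : ι → Type*}
    [∀ i, AddCommGroup (G i)] [∀ i, Module k (G i)] [∀ i, Coalgebra k (G i)]
    (f : ∀ i j, i ≤ j → G i →ₗc[k] G j) : Type _ :=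
  Module.DirectLimit G fun i j h => (f i j h).toLinearMap

namespace CoalgLimit

variable {k : Type*} [Field k] {ι : Type*} [Preorder ι]
  {G : ι → Type*} [∀ i, AddCommGroup (G i)] [∀ i, Module k (G i)] [∀ i, Coalgebra k (G i)]
  (f : ∀ i j, i ≤ j → G i →ₗc[k] G j)

open scoped Classical in
instance : AddCommGroup (CoalgLimit f) :=
  inferInstanceAs (AddCommGroup (Module.DirectLimit G fun i j h => (f i j h).toLinearMap))

open scoped Classical in
instance : Module k (CoalgLimit f) :=
  inferInstanceAs (Module k (Module.DirectLimit G fun i j h => (f i j h).toLinearMap))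

open scoped Classical in
/-- The canonical linear maps to the direct limit. -/
def ofₗ (i : ι) : G i →ₗ[k] CoalgLimit f :=
  Module.DirectLimit.of k ι G (fun i j h => (f i j h).toLinearMap) i

open scoped Classical in
theorem ofₗ_map {i j : ι} (h : i ≤ j) (x : G i) : ofₗ f j (f i j h x) = ofₗ f i x :=
  Module.DirectLimit.of_f (f := fun i j h => (f i j h).toLinearMap) (hij := h)

open scoped Classical in
/-- The linear map out of the direct limit given by a compatible family. -/
def liftₗ {P : Type*} [AddCommGroup P] [Module k P] (g : ∀ i, G i →ₗ[k] P)
    (hg : ∀ i j (h : i ≤ j) x, g j (f i j h x) = g i x) : CoalgLimit f →ₗ[k] P :=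
  Module.DirectLimit.lift k ι G (fun i j h => (f i j h).toLinearMap) g hg

open scoped Classical in
theorem liftₗ_comp_ofₗ {P : Type*} [AddCommGroup P] [Module k P] (g : ∀ i, G i →ₗ[k] P)
    (hg : ∀ i j (h : i ≤ j) x, g j (f i j h x) = g i x) (i : ι) :
    liftₗ f g hg ∘ₗ ofₗ f i = g i :=
  LinearMap.ext fun x => Module.DirectLimit.lift_of (f := fun i j h => (f i j h).toLinearMap) g hg x

open scoped Classical in
theorem hom_extₗ {P : Type*} [AddCommMonoid P] [Module k P] {p q : CoalgLimit f →ₗ[k] P}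
    (h : ∀ i, p ∘ₗ ofₗ f i = q ∘ₗ ofₗ f i) : p = q :=
  Module.DirectLimit.hom_ext (f := fun i j h => (f i j h).toLinearMap) h

open scoped Classical in
theorem liftₗ_injective [IsDirectedOrder ι] {P : Type*} [AddCommGroup P] [Module k P]
    (g : ∀ i, G i →ₗ[k] P) (hg : ∀ i j (h : i ≤ j) x, g j (f i j h x) = g i x)
    (hinj : ∀ i, Function.Injective (g i)) : Function.Injective (liftₗ f g hg) :=
  Module.DirectLimit.lift_injective (f := fun i j h => (f i j h).toLinearMap) g hg hinj

open scoped Classical in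
theorem exists_of [Nonempty ι] [IsDirectedOrder ι] (x : CoalgLimit f) : ∃ i y, ofₗ f i y = x :=
  Module.DirectLimit.exists_of (f := fun i j h => (f i j h).toLinearMap) x

/-- The coalgebra structure of the direct limit: the one that makes the canonical maps coalgebra
homomorphisms. -/
instance : CoalgebraStruct k (CoalgLimit f) where
  comul := liftₗ f (fun i => TensorProduct.map (ofₗ f i) (ofₗ f i) ∘ₗ CoalgebraStruct.comul) (by
    intro i j h x
    have h1 := LinearMap.congr_fun (f i j h).map_comp_comul x
    have h2 : ofₗ f j ∘ₗ (f i j h).toLinearMap = ofₗ f i := LinearMap.ext (ofₗ_map f h)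
    simp only [LinearMap.comp_apply] at h1 ⊢
    change TensorProduct.map (ofₗ f j) (ofₗ f j)
      (CoalgebraStruct.comul ((f i j h).toLinearMap x)) = _
    rw [← h1, ← LinearMap.comp_apply, ← TensorProduct.map_comp, h2])
  counit := liftₗ f (fun i => CoalgebraStruct.counit) fun i j h x =>
    LinearMap.congr_fun (f i j h).counit_comp x

theorem comul_comp_ofₗ (i : ι) : CoalgebraStruct.comul ∘ₗ ofₗ f i
    = TensorProduct.map (ofₗ f i) (ofₗ f i) ∘ₗ CoalgebraStruct.comul :=
  liftₗ_comp_ofₗ f _ _ i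

theorem counit_comp_ofₗ (i : ι) : CoalgebraStruct.counit ∘ₗ ofₗ f i
    = CoalgebraStruct.counit (R := k) :=
  liftₗ_comp_ofₗ f _ _ i

instance : Coalgebra k (CoalgLimit f) where
  coassoc := by
    refine hom_extₗ f fun i => ?_
    simp_rw [LinearMap.comp_assoc, comul_comp_ofₗ, ← LinearMap.comp_assoc,
      LinearMap.lTensor_comp_map, comul_comp_ofₗ, LinearMap.comp_assoc,
      ← LinearMap.comp_assoc CoalgebraStruct.comul, LinearMap.rTensor_comp_map, comul_comp_ofₗ,
      ← LinearMap.map_comp_rTensor, ← LinearMap.map_comp_lTensor, LinearMap.comp_assoc,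
      ← Coalgebra.coassoc, ← LinearMap.comp_assoc CoalgebraStruct.comul, ← LinearMap.comp_assoc,
      TensorProduct.map_map_comp_assoc_eq]
  rTensor_counit_comp_comul := by
    refine hom_extₗ f fun i => ?_
    rw [LinearMap.comp_assoc, comul_comp_ofₗ, ← LinearMap.comp_assoc, LinearMap.rTensor_comp_map,
      counit_comp_ofₗ, ← LinearMap.lTensor_comp_rTensor, LinearMap.comp_assoc,
      Coalgebra.rTensor_counit_comp_comul, LinearMap.lTensor_comp_mk]
  lTensor_counit_comp_comul := by
    refine hom_extₗ f fun i => ?_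
    rw [LinearMap.comp_assoc, comul_comp_ofₗ, ← LinearMap.comp_assoc, LinearMap.lTensor_comp_map,
      counit_comp_ofₗ, ← LinearMap.rTensor_comp_lTensor, LinearMap.comp_assoc,
      Coalgebra.lTensor_counit_comp_comul, LinearMap.rTensor_comp_flip_mk]

/-- The canonical coalgebra homomorphisms to the direct limit. -/
def of (i : ι) : G i →ₗc[k] CoalgLimit f where
  toLinearMap := ofₗ f i
  counit_comp := counit_comp_ofₗ f i
  map_comp_comul := (comul_comp_ofₗ f i).symm

theorem of_map {i j : ι} (h : i ≤ j) (x : G i) : of f j (f i j h x) = of f i x :=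
  ofₗ_map f h x

/-- The coalgebra homomorphism out of the direct limit given by a compatible family. -/
def lift {C : Type*} [AddCommGroup C] [Module k C] [Coalgebra k C] (g : ∀ i, G i →ₗc[k] C)
    (hg : ∀ i j (h : i ≤ j) x, g j (f i j h x) = g i x) : CoalgLimit f →ₗc[k] C where
  toLinearMap := liftₗ f (fun i => (g i).toLinearMap) hg
  counit_comp := by
    refine hom_extₗ f fun i => ?_
    rw [LinearMap.comp_assoc, liftₗ_comp_ofₗ, counit_comp_ofₗ, (g i).counit_comp]
  map_comp_comul := by
    refine hom_extₗ f fun i => ?_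
    rw [LinearMap.comp_assoc, LinearMap.comp_assoc, comul_comp_ofₗ, liftₗ_comp_ofₗ,
      ← LinearMap.comp_assoc, ← TensorProduct.map_comp, liftₗ_comp_ofₗ, (g i).map_comp_comul]

theorem lift_of {C : Type*} [AddCommGroup C] [Module k C] [Coalgebra k C] (g : ∀ i, G i →ₗc[k] C)
    (hg : ∀ i j (h : i ≤ j) x, g j (f i j h x) = g i x) (i : ι) (x : G i) :
    lift f g hg (of f i x) = g i x :=
  LinearMap.congr_fun (liftₗ_comp_ofₗ f _ hg i) x

end CoalgLimit

end DirectLimit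

noncomputable section DirectSum

open scoped Classical in
/-- The direct sum `⨁ i, G i` of a family of coalgebras: the finitely supported families, with the
coalgebra structure for which the inclusions of the summands are coalgebra homomorphisms. -/
def CoalgSum (k : Type*) [Field k] {ι : Type*} (G : ι → Type*) [∀ i, AddCommGroup (G i)]
    [∀ i, Module k (G i)] [∀ i, Coalgebra k (G i)] : Type _ := Π₀ i, G i

namespace CoalgSum

variable {k : Type*} [Field k] {ι : Type*} {G : ι → Type*} [∀ i, AddCommGroup (G i)]
  [∀ i, Module k (G i)] [∀ i, Coalgebra k (G i)]

instance : AddCommGroup (CoalgSum k G) := inferInstanceAs (AddCommGroup (Π₀ i, G i))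

instance : Module k (CoalgSum k G) := inferInstanceAs (Module k (Π₀ i, G i))

open scoped Classical in
instance : Coalgebra k (CoalgSum k G) := inferInstanceAs (Coalgebra k (Π₀ i, G i))

variable (k G) in
open scoped Classical in
/-- The inclusion of a summand. -/
def of (i : ι) : G i →ₗc[k] CoalgSum k G where
  toLinearMap := (DFinsupp.lsingle i : G i →ₗ[k] Π₀ i, G i)
  counit_comp := DFinsupp.counit_comp_lsingle k ι G i
  map_comp_comul := (DFinsupp.comul_comp_lsingle k ι G i).symm

open scoped Classical in
theorem hom_extₗ {P : Type*} [AddCommMonoid P] [Module k P] {p q : CoalgSum k G →ₗ[k] P}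
    (h : ∀ i, p ∘ₗ (of k G i).toLinearMap = q ∘ₗ (of k G i).toLinearMap) : p = q :=
  DFinsupp.lhom_ext' (M := G) h

open scoped Classical in
/-- The linear map out of a direct sum given by a family of linear maps. -/
def liftₗ {P : Type*} [AddCommGroup P] [Module k P] (g : ∀ i, G i →ₗ[k] P) : CoalgSum k G →ₗ[k] P :=
  (DFinsupp.lsum k g : (Π₀ i, G i) →ₗ[k] P)

open scoped Classical in
theorem liftₗ_comp_of {P : Type*} [AddCommGroup P] [Module k P] (g : ∀ i, G i →ₗ[k] P) (i : ι) :
    liftₗ g ∘ₗ (of k G i).toLinearMap = g i :=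
  LinearMap.ext fun x => (DFinsupp.lsum_single k g i x :)

/-- The homomorphism out of a direct sum given by a family of coalgebra homomorphisms. -/
def lift {C : Type*} [AddCommGroup C] [Module k C] [Coalgebra k C] (g : ∀ i, G i →ₗc[k] C) :
    CoalgSum k G →ₗc[k] C where
  toLinearMap := liftₗ fun i => (g i).toLinearMap
  counit_comp := by
    refine hom_extₗ fun i => ?_
    rw [LinearMap.comp_assoc, liftₗ_comp_of, (g i).counit_comp, (of k G i).counit_comp]
  map_comp_comul := by
    refine hom_extₗ fun i => ?_
    rw [LinearMap.comp_assoc, LinearMap.comp_assoc, ← (of k G i).map_comp_comul, liftₗ_comp_of,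
      ← LinearMap.comp_assoc, ← TensorProduct.map_comp, liftₗ_comp_of, (g i).map_comp_comul]

theorem lift_of {C : Type*} [AddCommGroup C] [Module k C] [Coalgebra k C] (g : ∀ i, G i →ₗc[k] C)
    (i : ι) (x : G i) : lift g (of k G i x) = g i x :=
  LinearMap.congr_fun (liftₗ_comp_of (fun i => (g i).toLinearMap) i) x

end CoalgSum

end DirectSum

noncomputable section Schemes

variable {k : Type u} [Field k]

variable (k) in
/-- Schemes over the field `k`, that is, over `Spec k`. -/
abbrev KScheme : Type (u + 1) := Over (Spec (CommRingCat.of k))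

/-- The algebra of global sections `Γ(X, 𝒪_X)`. -/
def Sections (X : KScheme k) : Type u := Γ(X.left, ⊤)

namespace Sections

instance (X : KScheme k) : CommRing (Sections X) := inferInstanceAs (CommRing Γ(X.left, ⊤))

/-- The structure homomorphism `k → Γ(X, 𝒪_X)`. -/
def structureHom (X : KScheme k) : CommRingCat.of k ⟶ Γ(X.left, ⊤) :=
  (Scheme.ΓSpecIso (CommRingCat.of k)).inv ≫ X.hom.appTop

instance (X : KScheme k) : Algebra k (Sections X) := (structureHom X).hom.toAlgebra

theorem structureHom_comp {X Y : KScheme k} (f : X ⟶ Y) :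
    structureHom Y ≫ f.left.appTop = structureHom X := by
  rw [structureHom, Category.assoc, ← Scheme.Hom.comp_appTop, Over.w f, structureHom]

/-- Pullback of global sections along a morphism of `k`-schemes. -/
def map {X Y : KScheme k} (f : X ⟶ Y) : Sections Y →ₐ[k] Sections X where
  __ := f.left.appTop.hom
  commutes' c := congrArg (fun g => g.hom c) (structureHom_comp f)

theorem map_comp {X Y Z : KScheme k} (f : X ⟶ Y) (g : Y ⟶ Z) :
    map (f ≫ g) = (map f).comp (map g) := by
  refine AlgHom.ext fun a => ?_
  change (f ≫ g).left.appTop.hom a = f.left.appTop.hom (g.left.appTop.hom a)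
  rw [Over.comp_left, Scheme.Hom.comp_appTop]
  rfl

/-- Global sections of a scheme that is finite over `k` form a finite-dimensional algebra. -/
theorem finite (X : KScheme k) (hX : IsFinite X.hom) : Module.Finite k (Sections X) := by
  have h := X.hom.finite_appTop
  have h2 : (structureHom X).hom.Finite := by
    rw [structureHom, CommRingCat.hom_comp]
    refine h.comp (RingHom.Finite.of_surjective _ ?_)
    exact (Scheme.ΓSpecIso (CommRingCat.of k)).commRingCatIsoToRingEquiv.symm.surjective
  exact h2

end Sections

theorem toSpecΓ_structureHom (X : KScheme k) :
    X.left.toSpecΓ ≫ Spec.map (Sections.structureHom X) = X.hom := by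
  rw [Sections.structureHom, Spec.map_comp, ← Scheme.toSpecΓ_naturality_assoc,
    ← SpecMap_ΓSpecIso_hom, ← Spec.map_comp]
  simp

/-- An affine `k`-scheme with finite-dimensional algebra of global sections is finite over `k`. -/
theorem isFinite_of_affine (X : KScheme k) [IsAffine X.left] (h : Module.Finite k (Sections X)) :
    IsFinite X.hom := by
  have h2 : IsFinite (Spec.map (Sections.structureHom X)) :=
    (IsFinite.SpecMap_iff (Sections.structureHom X)).mpr h
  rw [← toSpecΓ_structureHom]
  infer_instance

/-- The set `ℱ(X)` of closed subschemes of `X`, given by their quasi-coherent ideal sheaves, that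
are finite over `k`. -/
def FiniteSub (X : KScheme k) : Type u :=
  {I : X.left.IdealSheafData // IsFinite (I.subschemeι ≫ X.hom)}

namespace FiniteSub

variable {X : KScheme k}

/-- Closed subschemes are ordered by inclusion: `S ≤ T` means that the ideal sheaf of `T` is
contained in that of `S`. -/
instance : Preorder (FiniteSub X) where
  le S T := T.1 ≤ S.1
  le_refl S := le_refl S.1
  le_trans _ _ _ h h' := le_trans h' h

/-- The closed subscheme as a `k`-scheme. -/
def scheme (S : FiniteSub X) : KScheme k := Over.mk (S.1.subschemeι ≫ X.hom)

/-- The closed immersion into `X`. -/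
def ι (S : FiniteSub X) : S.scheme ⟶ X := Over.homMk S.1.subschemeι rfl

/-- The closed immersion between closed subschemes. -/
def incl {S T : FiniteSub X} (h : S ≤ T) : S.scheme ⟶ T.scheme :=
  Over.homMk (Scheme.IdealSheafData.inclusion h) (by
    simp [scheme])

theorem incl_ι {S T : FiniteSub X} (h : S ≤ T) : incl h ≫ T.ι = S.ι := by
  ext1
  exact Scheme.IdealSheafData.inclusion_subschemeι h

instance (S : FiniteSub X) : IsFinite S.scheme.hom := S.2

instance (S : FiniteSub X) : Mono S.ι.left := inferInstanceAs (Mono S.1.subschemeι)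

instance (S : FiniteSub X) : Module.Finite k (Sections S.scheme) := Sections.finite _ S.2

theorem hom_ext {W : KScheme k} (S : FiniteSub X) {f g : W ⟶ S.scheme} (h : f ≫ S.ι = g ≫ S.ι) :
    f = g := by
  ext1
  rw [← cancel_mono S.ι.left]
  exact congrArg CommaMorphism.left h

end FiniteSub

/-- The coalgebra of distributions of finite support: the direct limit of the dual coalgebras
`Γ(S, 𝒪_S)^*` over the closed subschemes `S` of `X` that are finite over `k`. -/
abbrev Dist (X : KScheme k) : Type u :=
  CoalgLimit (ι := FiniteSub X) (G := fun S => Module.Dual k (Sections S.scheme))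
    fun _ _ h => dualMap (Sections.map (FiniteSub.incl h))

/-- The canonical map `Dist S = Γ(S, 𝒪_S)^* → Dist X` for `S` in `ℱ(X)`. -/
def Dist.of {X : KScheme k} (S : FiniteSub X) :
    Module.Dual k (Sections S.scheme) →ₗc[k] Dist X :=
  CoalgLimit.of (ι := FiniteSub X) (G := fun S => Module.Dual k (Sections S.scheme))
    (fun _ _ h => dualMap (Sections.map (FiniteSub.incl h))) S

theorem Dist.of_incl {X : KScheme k} {S T : FiniteSub X} (h : S ≤ T)
    (φ : Module.Dual k (Sections S.scheme)) :
    Dist.of T (dualMap (Sections.map (FiniteSub.incl h)) φ) = Dist.of S φ :=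
  CoalgLimit.of_map (ι := FiniteSub X) (G := fun S => Module.Dual k (Sections S.scheme)) _ h φ

/-- A morphism is scheme-theoretically dominant onto its image. -/
theorem ker_toImage {X Y : Scheme.{u}} (f : X ⟶ Y) [QuasiCompact f] :
    IsSchemeTheoreticallyDominant f.toImage := by
  constructor
  refine Scheme.IdealSheafData.ext_of_iSup_eq_top
    (fun U : Y.affineOpens => ⟨f.imageι ⁻¹ᵁ U.1, U.2.preimage f.imageι⟩) ?_ fun U => ?_
  · rw [← Scheme.Hom.preimage_iSup, iSup_affineOpens_eq_top, Scheme.Hom.preimage_top]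
  · rw [Scheme.Hom.ker_apply, Scheme.IdealSheafData.ideal_bot, Pi.bot_apply,
      ← RingHom.injective_iff_ker_eq_bot]
    exact f.toImage_app_injective U

theorem isArtinianScheme_of_isFinite (S : KScheme k) [IsFinite S.hom] :
    IsArtinianScheme S.left := by
  have : IsAffine S.left := isAffine_of_isAffineHom S.hom
  have hS : Module.Finite k (Sections S) := Sections.finite S inferInstance
  have hart : IsArtinianRing (Sections S) := IsArtinianRing.of_finite k _
  have : IsArtinianScheme (Spec Γ(S.left, ⊤)) := Scheme.isArtinianScheme_Spec.mpr hart
  have : IsLocallyArtinian S.left := .of_isImmersion S.left.isoSpec.hom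
  exact { }

/-- The scheme-theoretic image of a scheme finite over `k` is finite over `k`. -/
theorem isFinite_image {S Y : KScheme k} [IsFinite S.hom] (g : S ⟶ Y) :
    IsFinite (g.left.imageι ≫ Y.hom) := by
  have : IsArtinianScheme S.left := isArtinianScheme_of_isFinite S
  have : QuasiCompact g.left := ⟨fun U _ _ => (Set.toFinite _).isCompact⟩
  have := ker_toImage g.left
  have : QuasiCompact g.left.toImage := ⟨fun U _ _ => (Set.toFinite _).isCompact⟩
  have : IsLocallyArtinian g.left.image := by
    refine ⟨fun U => ?_⟩
    let V := g.left.toImage ⁻¹ᵁ U.1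
    have hV : IsClosedImmersion V.ι := .of_isPreimmersion _ (isClosed_discrete _)
    have hVf : IsFinite (V.ι ≫ S.hom) := inferInstance
    have h1 : Module.Finite k (Sections (Over.mk (V.ι ≫ S.hom))) := Sections.finite _ hVf
    let h : Over.mk (V.ι ≫ S.hom) ⟶ Over.mk (U.1.ι ≫ g.left.imageι ≫ Y.hom) :=
      Over.homMk (g.left.toImage ∣_ U.1) (by simp [V])
    have hinj : Function.Injective (Sections.map h) := by
      change Function.Injective (g.left.toImage ∣_ U.1).appTop
      have he := morphismRestrict_appTop g.left.toImage U.1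
      refine (congrArg (fun p => Function.Injective (ConcreteCategory.hom p)) he).mpr ?_
      exact (ConcreteCategory.bijective_of_isIso (S.left.presheaf.map
        (eqToHom (image_morphismRestrict_preimage g.left.toImage U.1 ⊤)).op)).1.comp
        (g.left.toImage.app_injective (U.1.ι ''ᵁ ⊤))
    have h2 : Module.Finite k (Sections (Over.mk (U.1.ι ≫ g.left.imageι ≫ Y.hom))) :=
      Module.Finite.of_injective (Sections.map h).toLinearMap hinj
    have h3 : IsArtinianRing (Sections (Over.mk (U.1.ι ≫ g.left.imageι ≫ Y.hom))) :=
      IsArtinianRing.of_finite k _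
    have h4 : IsArtinianRing Γ(U.1.toScheme, ⊤) := h3
    exact U.1.topIso.commRingCatIsoToRingEquiv.surjective.isArtinianRing
  have hsurj : Function.Surjective g.left.toImage := by
    have hd : DenseRange g.left.toImage := g.left.toImage.denseRange
    have := hd.closure_range
    rwa [(isClosed_discrete _).closure_eq, Set.range_eq_univ] at this
  have : Finite g.left.image := Finite.of_surjective _ hsurj
  have : IsAffine g.left.image := inferInstance
  let Z : KScheme k := Over.mk (g.left.imageι ≫ Y.hom)
  have : IsAffine Z.left := ‹IsAffine g.left.image›
  refine isFinite_of_affine Z ?_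
  let h : S ⟶ Z := Over.homMk g.left.toImage (by simp [Z])
  have hS : Module.Finite k (Sections S) := Sections.finite S inferInstance
  exact Module.Finite.of_injective (Sections.map h).toLinearMap (g.left.toImage.app_injective ⊤)

namespace FiniteSub

/-- The scheme-theoretic image in `Y` of a scheme `S` finite over `k`. -/
def image {S Y : KScheme k} [IsFinite S.hom] (g : S ⟶ Y) : FiniteSub Y :=
  ⟨g.left.ker, isFinite_image g⟩

/-- The morphism from `S` to its scheme-theoretic image. -/
def toImage {S Y : KScheme k} [IsFinite S.hom] (g : S ⟶ Y) : S ⟶ (image g).scheme :=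
  Over.homMk g.left.toImage (by
    change g.left.toImage ≫ g.left.imageι ≫ Y.hom = S.hom
    simp)

theorem toImage_ι {S Y : KScheme k} [IsFinite S.hom] (g : S ⟶ Y) : toImage g ≫ (image g).ι = g := by
  ext1
  exact g.left.toImage_imageι

theorem image_mono {X Y : KScheme k} (f : X ⟶ Y) {S T : FiniteSub X} (h : S ≤ T) :
    image (S.ι ≫ f) ≤ image (T.ι ≫ f) := by
  have h1 : incl h ≫ T.ι ≫ f = S.ι ≫ f := by rw [← Category.assoc, incl_ι]
  change (T.ι ≫ f).left.ker ≤ (S.ι ≫ f).left.ker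
  rw [← h1]
  exact Scheme.Hom.le_ker_comp (incl h).left (T.ι ≫ f).left

end FiniteSub

/-- Any two closed subschemes finite over `k` are contained in a third one. -/
instance (X : KScheme k) : IsDirectedOrder (FiniteSub X) where
  directed S T := by
    let g := Limits.coprod.desc S.1.subschemeι T.1.subschemeι
    have hg : g ≫ X.hom = Limits.coprod.desc (S.1.subschemeι ≫ X.hom) (T.1.subschemeι ≫ X.hom) := by
      ext1 <;> simp [g]
    have hS := S.2
    have hT := T.2
    let W : KScheme k := Over.mk (g ≫ X.hom)
    have : IsFinite W.hom := by
      change IsFinite (g ≫ X.hom)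
      rw [hg]
      infer_instance
    let g' : W ⟶ X := Over.homMk g rfl
    refine ⟨FiniteSub.image g', ?_, ?_⟩
    · have h : g.ker ≤ (Limits.coprod.inl ≫ g).ker := Scheme.Hom.le_ker_comp _ _
      rw [Limits.coprod.inl_desc, Scheme.IdealSheafData.ker_subschemeι] at h
      exact h
    · have h : g.ker ≤ (Limits.coprod.inr ≫ g).ker := Scheme.Hom.le_ker_comp _ _
      rw [Limits.coprod.inr_desc, Scheme.IdealSheafData.ker_subschemeι] at h
      exact h

instance (X : KScheme k) : Nonempty (FiniteSub X) :=
  ⟨⟨⊤, inferInstance⟩⟩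

/-- The functoriality of `Dist`: for `S` in `ℱ(X)` with scheme-theoretic image `S'` in `Y`, the map
`Γ(S, 𝒪_S)^* → Γ(S', 𝒪_S')^*` is the transpose of pullback along `S → S'`. -/
def Dist.map {X Y : KScheme k} (f : X ⟶ Y) : Dist X →ₗc[k] Dist Y :=
  CoalgLimit.lift _
    (fun S => (Dist.of (FiniteSub.image (S.ι ≫ f))).comp
      (dualMap (Sections.map (FiniteSub.toImage (S.ι ≫ f)))))
    (by
      intro S T h φ
      have hm := FiniteSub.image_mono f h
      refine Eq.trans ?_ (Dist.of_incl hm _)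
      refine congrArg (Dist.of (FiniteSub.image (T.ι ≫ f))) ?_
      have h1 : FiniteSub.incl h ≫ FiniteSub.toImage (T.ι ≫ f)
          = FiniteSub.toImage (S.ι ≫ f) ≫ FiniteSub.incl hm := by
        refine FiniteSub.hom_ext _ ?_
        rw [Category.assoc, Category.assoc, FiniteSub.toImage_ι, FiniteSub.incl_ι,
          FiniteSub.toImage_ι, ← Category.assoc, FiniteSub.incl_ι]
      have h2 : (Sections.map (FiniteSub.incl h)).comp (Sections.map (FiniteSub.toImage (T.ι ≫ f)))
          = (Sections.map (FiniteSub.toImage (S.ι ≫ f))).comp (Sections.map (FiniteSub.incl hm)) := by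
        rw [← Sections.map_comp, ← Sections.map_comp, h1]
      exact congrArg (fun p : Sections (FiniteSub.image (T.ι ≫ f)).scheme →ₐ[k] Sections S.scheme =>
        φ ∘ₗ p.toLinearMap) h2)

theorem Dist.map_of {X Y : KScheme k} (f : X ⟶ Y) (S : FiniteSub X)
    (φ : Module.Dual k (Sections S.scheme)) :
    Dist.map f (Dist.of S φ) = Dist.of (FiniteSub.image (S.ι ≫ f))
      (dualMap (Sections.map (FiniteSub.toImage (S.ι ≫ f))) φ) :=
  CoalgLimit.lift_of (ι := FiniteSub X) (G := fun S => Module.Dual k (Sections S.scheme)) _ _ _ S φ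

end Schemes
noncomputable section Points

variable {k : Type u} [Field k]

section Affine

theorem Dist.toFiniteDual_compat {X : KScheme k} {S T : FiniteSub X} (h : S ≤ T)
    (φ : Module.Dual k (Sections S.scheme)) :
    FiniteDual.ofDual (Sections.map T.ι) (dualMap (Sections.map (FiniteSub.incl h)) φ)
      = FiniteDual.ofDual (Sections.map S.ι) φ := by
  refine FiniteDual.incl_injective ?_
  have h2 : (Sections.map (FiniteSub.incl h)).comp (Sections.map T.ι) = Sections.map S.ι := by
    rw [← Sections.map_comp, FiniteSub.incl_ι]
  exact congrArg (fun p : Sections X →ₐ[k] Sections S.scheme => φ ∘ₗ p.toLinearMap) h2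

/-- The map `Dist X → Γ(X, 𝒪_X)°` that pulls back functionals along `Γ(X, 𝒪_X) → Γ(S, 𝒪_S)`. -/
def Dist.toFiniteDual (X : KScheme k) : Dist X →ₗc[k] FiniteDual k (Sections X) :=
  CoalgLimit.lift _ (fun S => FiniteDual.ofDual (Sections.map S.ι))
    fun _ _ h φ => Dist.toFiniteDual_compat h φ

theorem Dist.toFiniteDual_of (X : KScheme k) (S : FiniteSub X)
    (φ : Module.Dual k (Sections S.scheme)) :
    Dist.toFiniteDual X (Dist.of S φ) = FiniteDual.ofDual (Sections.map S.ι) φ :=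
  CoalgLimit.lift_of (ι := FiniteSub X) (G := fun S => Module.Dual k (Sections S.scheme)) _ _ _ S φ

theorem FiniteSub.map_ι_surjective {X : KScheme k} [IsAffine X.left] (S : FiniteSub X) :
    Function.Surjective (Sections.map S.ι) :=
  (IsClosedImmersion.isAffine_surjective_of_isAffine S.1.subschemeι).2

/-- For affine `X`, the map `Dist X → Γ(X, 𝒪_X)°` is bijective. -/
theorem Dist.toFiniteDual_bijective (X : KScheme k) [IsAffine X.left] :
    Function.Bijective (Dist.toFiniteDual X) := by
  constructor
  · refine CoalgLimit.liftₗ_injective (ι := FiniteSub X)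
      (G := fun S => Module.Dual k (Sections S.scheme)) _
      (fun S => (FiniteDual.ofDual (Sections.map S.ι)).toLinearMap)
      (fun _ _ h φ => Dist.toFiniteDual_compat h φ) fun S φ ψ h => ?_
    refine LinearMap.ext fun b => ?_
    obtain ⟨a, rfl⟩ := S.map_ι_surjective b
    exact LinearMap.congr_fun (congrArg (FiniteDual.incl k _) h) a
  · intro φ
    obtain ⟨I, hI, h⟩ := φ.incl_mem
    let J : X.left.IdealSheafData := .ofIdealTop I
    let Z : KScheme k := Over.mk (J.subschemeι ≫ X.hom)
    let i : Z ⟶ X := Over.homMk J.subschemeι rfl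
    have hZ := IsClosedImmersion.isAffine_surjective_of_isAffine J.subschemeι
    have : IsAffine Z.left := hZ.1
    have hsurj : Function.Surjective (Sections.map i) := hZ.2
    have hker : ∀ a : Sections X, Sections.map i a = 0 ↔ a ∈ I := fun a => by
      have h1 := J.ker_subschemeι_app ⟨⊤, isAffineOpen_top X.left⟩
      have h2 : J.ideal ⟨⊤, isAffineOpen_top X.left⟩ = I :=
        Scheme.IdealSheafData.equivOfIsAffine.apply_symm_apply I
      rw [h2] at h1
      exact (SetLike.ext_iff.mp h1 a)
    have hfin : Module.Finite k (Sections Z) :=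
      Module.Finite.of_surjective
        (Ideal.Quotient.liftₐ I (Sections.map i) fun a ha => (hker a).mpr ha).toLinearMap
        (Ideal.Quotient.lift_surjective_of_surjective I (fun a ha => (hker a).mpr ha) hsurj)
    let S : FiniteSub X := ⟨J, isFinite_of_affine Z hfin⟩
    have hφ : LinearMap.ker (Sections.map i).toLinearMap ≤ LinearMap.ker (FiniteDual.incl k _ φ) :=
      fun a ha => h a ((hker a).mp ha)
    have hmem : FiniteDual.incl k _ φ ∈ LinearMap.range (Sections.map i).toLinearMap.dualMap := by
      rw [LinearMap.range_dualMap_eq_dualAnnihilator_ker, Submodule.mem_dualAnnihilator]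
      exact fun a ha => hφ ha
    obtain ⟨ψ, hψ⟩ := hmem
    exact ⟨Dist.of S ψ, FiniteDual.incl_injective ((congrArg _ (Dist.toFiniteDual_of X S ψ)).trans hψ)⟩

variable (k) in
/-- `Spec A` as a `k`-scheme, for a commutative `k`-algebra `A`. -/
def specOver (A : Type u) [CommRing A] [Algebra k A] : KScheme k :=
  Over.mk (Spec.map (CommRingCat.ofHom (algebraMap k A)))

instance (A : Type u) [CommRing A] [Algebra k A] : IsAffine (specOver k A).left :=
  inferInstanceAs (IsAffine (Spec (CommRingCat.of A)))

variable (k) in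
/-- The isomorphism `A ≅ Γ(Spec A, 𝒪)`. -/
def sectionsSpecEquiv (A : Type u) [CommRing A] [Algebra k A] : A ≃ₐ[k] Sections (specOver k A) :=
  AlgEquiv.ofRingEquiv (f := (Scheme.ΓSpecIso (CommRingCat.of A)).symm.commRingCatIsoToRingEquiv)
    (fun c => congrArg (fun g => g.hom c)
      (Scheme.ΓSpecIso_inv_naturality (CommRingCat.ofHom (algebraMap k A))))

theorem FiniteDual.map_bijective {A B : Type*} [CommRing A] [Algebra k A] [CommRing B] [Algebra k B]
    (e : A ≃ₐ[k] B) : Function.Bijective (FiniteDual.map (k := k) e.toAlgHom) := by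
  refine ⟨fun φ ψ h => FiniteDual.incl_injective (LinearMap.ext fun b => ?_), fun φ => ?_⟩
  · have := LinearMap.congr_fun (congrArg (FiniteDual.incl k _) h) (e.symm b)
    change FiniteDual.incl k _ φ (e (e.symm b)) = FiniteDual.incl k _ ψ (e (e.symm b)) at this
    simpa using this
  · refine ⟨FiniteDual.map e.symm.toAlgHom φ, FiniteDual.incl_injective (LinearMap.ext fun a => ?_)⟩
    change FiniteDual.incl k _ φ (e.symm (e a)) = _
    simp

variable (k) in
/-- The isomorphism `Dist (Spec A) ≅ A°` of coalgebras. It sends the class of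
`φ : Γ(S, 𝒪_S) → k` to the composite of `φ` with `A → Γ(S, 𝒪_S)`. -/
def distSpecEquiv (A : Type u) [CommRing A] [Algebra k A] :
    Dist (specOver k A) ≃ₗc[k] FiniteDual k A :=
  CoalgEquiv.ofBijective
    (f := (FiniteDual.map (sectionsSpecEquiv k A).toAlgHom).comp (Dist.toFiniteDual (specOver k A)))
    ((FiniteDual.map_bijective (sectionsSpecEquiv k A)).comp
      (Dist.toFiniteDual_bijective (specOver k A)))

end Affine

/-- The local ring `𝒪_{X,x}`. -/
def LocalRing (X : KScheme k) (x : X.left) : Type u := X.left.presheaf.stalk x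

namespace LocalRing

instance (X : KScheme k) (x : X.left) : CommRing (LocalRing X x) :=
  inferInstanceAs (CommRing (X.left.presheaf.stalk x))

/-- The structure homomorphism `k → Γ(X, 𝒪_X) → 𝒪_{X,x}`. -/
def structureHom (X : KScheme k) (x : X.left) : CommRingCat.of k ⟶ X.left.presheaf.stalk x :=
  Sections.structureHom X ≫ X.left.presheaf.germ ⊤ x (TopologicalSpace.Opens.mem_top x)

instance (X : KScheme k) (x : X.left) : Algebra k (LocalRing X x) := (structureHom X x).hom.toAlgebra

theorem structureHom_comp {X Y : KScheme k} (f : X ⟶ Y) (x : X.left) :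
    structureHom Y (f.left x) ≫ f.left.stalkMap x = structureHom X x := by
  rw [structureHom, Category.assoc, Scheme.Hom.germ_stalkMap, structureHom,
    ← Sections.structureHom_comp f, Category.assoc]
  rfl

/-- The homomorphism `𝒪_{Y,f(x)} → 𝒪_{X,x}` induced by a morphism of `k`-schemes. -/
def map {X Y : KScheme k} (f : X ⟶ Y) (x : X.left) : LocalRing Y (f.left x) →ₐ[k] LocalRing X x where
  __ := (f.left.stalkMap x).hom
  commutes' c := congrArg (fun g => g.hom c) (structureHom_comp f x)

/-- The canonical morphism `Spec 𝒪_{X,x} → X` of `k`-schemes. -/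
def fromSpec (X : KScheme k) (x : X.left) : specOver k (LocalRing X x) ⟶ X :=
  Over.homMk (X.left.fromSpecStalk x) (by
    have h : X.left.fromSpecStalk x ≫ X.hom = Spec.map (structureHom X x) := by
      rw [← toSpecΓ_structureHom X, Scheme.fromSpecStalk_toSpecΓ_assoc, ← Spec.map_comp]
      rfl
    exact h)

end LocalRing

/-- The residue field `κ(x)`. -/
def ResField (X : KScheme k) (x : X.left) : Type u := X.left.residueField x

namespace ResField

instance (X : KScheme k) (x : X.left) : Field (ResField X x) :=
  inferInstanceAs (Field (X.left.residueField x))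

instance (X : KScheme k) (x : X.left) : Algebra k (ResField X x) :=
  (LocalRing.structureHom X x ≫ X.left.residue x).hom.toAlgebra

/-- The extension `κ(f(x)) → κ(x)` of residue fields induced by a morphism of `k`-schemes. -/
def map {X Y : KScheme k} (f : X ⟶ Y) (x : X.left) : ResField Y (f.left x) →ₐ[k] ResField X x where
  __ := (f.left.residueFieldMap x).hom
  commutes' c := congrArg (fun g => g.hom c) (show (LocalRing.structureHom Y (f.left x) ≫
      Y.left.residue (f.left x)) ≫ f.left.residueFieldMap x
        = LocalRing.structureHom X x ≫ X.left.residue x by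
    rw [Category.assoc, Scheme.residue_residueFieldMap, ← Category.assoc,
      LocalRing.structureHom_comp])

end ResField

/-- The set `fin(X)` of the points `x` with `[κ(x) : k] < ∞`. -/
def finPoints (X : KScheme k) : Set X.left := {x | Module.Finite k (ResField X x)}

theorem map_mem_finPoints {X Y : KScheme k} (f : X ⟶ Y) {x : X.left} (hx : x ∈ finPoints X) :
    f.left x ∈ finPoints Y :=
  have : Module.Finite k (ResField X x) := hx
  Module.Finite.of_injective (ResField.map f x).toLinearMap (ResField.map f x).toRingHom.injective

/-- The coalgebra `Dist(X, x) = (𝒪_{X,x})°` of distributions supported at `x`. -/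
abbrev DistAt (X : KScheme k) (x : X.left) : Type u := FiniteDual k (LocalRing X x)

/-- The coalgebra homomorphism `Dist(X, x) = (𝒪_{X,x})° ≅ Dist(Spec 𝒪_{X,x}) → Dist(X)` induced by
the canonical morphism `Spec 𝒪_{X,x} → X`. -/
def DistAt.toDist (X : KScheme k) (x : X.left) : DistAt X x →ₗc[k] Dist X :=
  (Dist.map (LocalRing.fromSpec X x)).comp (distSpecEquiv k (LocalRing X x)).symm

/-- The direct sum of coalgebras `⨁ Dist(X, x)` over the points `x` of a set `P`. -/
abbrev DistSum (X : KScheme k) (P : Set X.left) : Type u :=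
  CoalgSum k fun x : P => DistAt X x.1

/-- The coalgebra homomorphism `⨁ Dist(X, x) → Dist(X)` induced by the canonical morphisms
`Spec 𝒪_{X,x} → X`. -/
def DistSum.toDist (X : KScheme k) (P : Set X.left) : DistSum X P →ₗc[k] Dist X :=
  CoalgSum.lift fun x : P => DistAt.toDist X x.1

/-- For a morphism `f : X → Y` of `k`-schemes, the homomorphism
`⨁_{x ∈ fin(X)} Dist(X, x) → ⨁_{y ∈ fin(Y)} Dist(Y, y)` whose restriction to `Dist(X, x)` is the map
`Dist(X, x) → Dist(Y, f(x))` dual to `𝒪_{Y,f(x)} → 𝒪_{X,x}`. -/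
def DistSum.map {X Y : KScheme k} (f : X ⟶ Y) :
    DistSum X (finPoints X) →ₗc[k] DistSum Y (finPoints Y) :=
  CoalgSum.lift fun x : finPoints X =>
    (CoalgSum.of k (fun y : finPoints Y => DistAt Y y.1) ⟨f.left x.1, map_mem_finPoints f x.2⟩).comp
      (FiniteDual.map (LocalRing.map f x.1))

end Points

end SchemeDist

open SchemeDist

/-!
A scheme `S` finite over `k` is discrete as a topological space, so that `Γ(S, 𝒪_S)` is the product
of the finitely many local rings `𝒪_{S,s}` and `Γ(S, 𝒪_S)^*` is the direct sum of the
`Dist(S, s)`. For a closed subscheme `S` of `X`, pushing this decomposition forward along `S ⟶ X`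
gives a homomorphism from `Γ(S, 𝒪_S)^*` to `⨁ Dist(X, x)`; these are compatible with each other and
define `Dist(X) → ⨁ Dist(X, x)`, naturally in `X`, which is a right inverse of
`⨁ Dist(X, x) → Dist(X)` because it is one for each `S`. It is also a left inverse: by naturality
along `Spec 𝒪_{X,x} ⟶ X` this is a statement about `Spec 𝒪_{X,x}`, whose only point with finite
residue field is the closed one.
-/

namespace SchemeDist

section Algebra

variable {k : Type*} [Field k]

theorem CoalgSum.hom_ext {ι : Type*} {G : ι → Type*} [∀ i, AddCommGroup (G i)]
    [∀ i, Module k (G i)] [∀ i, Coalgebra k (G i)] {C : Type*} [AddCommGroup C] [Module k C]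
    [Coalgebra k C] {p q : CoalgSum k G →ₗc[k] C}
    (h : ∀ i (x : G i), p (of k G i x) = q (of k G i x)) : p = q :=
  CoalgHom.coe_linearMap_injective <| hom_extₗ fun i => LinearMap.ext (h i)

theorem CoalgSum.eq_top_of_forall_of_mem {ι : Type*} {G : ι → Type*} [∀ i, AddCommGroup (G i)]
    [∀ i, Module k (G i)] [∀ i, Coalgebra k (G i)] {S : Submodule k (CoalgSum k G)}
    (h : ∀ i (x : G i), of k G i x ∈ S) : S = ⊤ := by
  rw [← S.ker_mkQ, LinearMap.ker_eq_top]
  exact hom_extₗ fun i => LinearMap.ext fun x => (Submodule.Quotient.mk_eq_zero S).mpr (h i x)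

namespace FiniteDual

variable {A B : Type*} [CommRing A] [Algebra k A] [CommRing B] [Algebra k B]

theorem ext {φ ψ : FiniteDual k A} (h : ∀ a, incl k A φ a = incl k A ψ a) : φ = ψ :=
  incl_injective (LinearMap.ext h)

theorem finite_of_surjective_of_isLocalRing [IsLocalRing A] [Nontrivial (FiniteDual k A)]
    {K : Type*} [Field K] [Algebra k K] {ρ : A →ₐ[k] K} (hρ : Function.Surjective ρ) :
    Module.Finite k K := by
  obtain ⟨φ, hφ⟩ := exists_ne (0 : FiniteDual k A)
  obtain ⟨I, hI, hφI⟩ := φ.incl_mem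
  have hI_ne_top : I ≠ ⊤ := by
    rintro rfl
    exact hφ (ext fun a => hφI a trivial)
  have hker : RingHom.ker ρ = IsLocalRing.maximalIdeal A :=
    IsLocalRing.eq_maximalIdeal (RingHom.ker_isMaximal_of_surjective ρ hρ)
  have hle : I ≤ RingHom.ker ρ := hker ▸ IsLocalRing.le_maximalIdeal hI_ne_top
  exact Module.Finite.of_surjective (Ideal.Quotient.liftₐ I ρ hle).toLinearMap
    (Ideal.Quotient.lift_surjective_of_surjective I hle hρ)

end FiniteDual

section Pi

variable {ι : Type*} (A : ι → Type*) [∀ i, CommRing (A i)] [∀ i, Algebra k (A i)]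

section Restrict

variable [DecidableEq ι]

theorem FiniteDual.comp_single_mem (φ : FiniteDual k (∀ i, A i)) (i : ι) :
    incl k _ φ ∘ₗ LinearMap.single k A i ∈ finiteDualSubmodule k (A i) := by
  obtain ⟨I, hI, hφI⟩ := φ.incl_mem
  let ev : (∀ i, A i) →ₐ[k] A i := Pi.evalAlgHom k A i
  have hev : Function.Surjective ev := Function.surjective_eval i
  refine ⟨I.map ev, ?_, fun a ha => hφI _ ?_⟩
  · exact Module.Finite.of_surjective
      (Ideal.quotientMapₐ (I.map ev) ev Ideal.le_comap_map).toLinearMap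
      (Ideal.quotientMap_surjective (H := Ideal.le_comap_map) hev)
  · obtain ⟨b, hb, rfl⟩ := (Ideal.mem_map_iff_of_surjective ev hev).mp ha
    have hsingle : LinearMap.single k A i (ev b) = Pi.single i 1 * b := by
      rw [← Pi.single_mul_left, one_mul]
      rfl
    exact hsingle ▸ I.mul_mem_left _ hb

/-- The restriction of a functional on a product of algebras to a factor. It is not an instance of
`FiniteDual.map`, since the inclusion of a factor does not preserve the unit. -/
def FiniteDual.restrict (i : ι) : FiniteDual k (∀ i, A i) →ₗ[k] FiniteDual k (A i) :=
  codRestrict ((LinearMap.single k A i).dualMap ∘ₗ incl k _) fun φ => comp_single_mem A φ i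

theorem FiniteDual.restrict_map_eval_same (i : ι) (ψ : FiniteDual k (A i)) :
    restrict A i (map (Pi.evalAlgHom k A i) ψ) = ψ :=
  ext fun a => congrArg (incl k _ ψ) (Pi.single_eq_same i a)

theorem FiniteDual.restrict_map_eval_of_ne {i j : ι} (h : i ≠ j) (ψ : FiniteDual k (A j)) :
    restrict A i (map (Pi.evalAlgHom k A j) ψ) = 0 :=
  ext fun a => (congrArg (incl k _ ψ) (Pi.single_eq_of_ne' h a)).trans (map_zero _)

theorem FiniteDual.sum_map_eval_restrict [Fintype ι] (φ : FiniteDual k (∀ i, A i)) :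
    ∑ i, map (Pi.evalAlgHom k A i) (restrict A i φ) = φ := by
  refine ext fun a => ?_
  calc incl k _ (∑ i, map (Pi.evalAlgHom k A i) (restrict A i φ)) a
      = ∑ i, incl k _ φ (Pi.single i (a i)) := by
        rw [map_sum, LinearMap.sum_apply]
        rfl
    _ = incl k _ φ a := by rw [← map_sum, Finset.univ_sum_single]

end Restrict

theorem FiniteDual.lift_map_eval_bijective [Finite ι] :
    Function.Bijective (CoalgSum.lift fun i => map (k := k) (Pi.evalAlgHom k A i)) := by
  classical
  have := Fintype.ofFinite ι
  let G i := FiniteDual k (A i)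
  let inv : FiniteDual k (∀ i, A i) →ₗ[k] CoalgSum k G :=
    ∑ i, (CoalgSum.of k G i).toLinearMap ∘ₗ restrict A i
  have inv_apply φ : inv φ = ∑ i, CoalgSum.of k G i (restrict A i φ) :=
    LinearMap.sum_apply ..
  refine Function.bijective_iff_has_inverse.mpr ⟨inv, fun d => ?_, fun φ => ?_⟩
  · refine LinearMap.congr_fun (f := inv ∘ₗ (CoalgSum.lift _).toLinearMap) (g := LinearMap.id)
      (CoalgSum.hom_extₗ fun j => LinearMap.ext fun ψ => ?_) d
    change inv (CoalgSum.lift _ (CoalgSum.of k G j ψ)) = CoalgSum.of k G j ψ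
    rw [CoalgSum.lift_of, inv_apply, Finset.sum_eq_single_of_mem j (Finset.mem_univ j),
      restrict_map_eval_same]
    intro i _ hij
    rw [restrict_map_eval_of_ne A hij, map_zero]
  · rw [inv_apply, map_sum]
    exact (Finset.sum_congr rfl fun i _ => CoalgSum.lift_of _ i _).trans
      (sum_map_eval_restrict A φ)

end Pi

end Algebra

section Germs

open TopologicalSpace

theorem germ_bijective_of_discreteTopology {C : Type*} [Category.{u} C] {FC : C → C → Type*}
    {CC : C → Type u} [∀ A B, FunLike (FC A B) (CC A) (CC B)] [ConcreteCategory.{u} C FC]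
    [Limits.HasColimits C] [Limits.HasLimits C] [Limits.PreservesLimits (forget C)]
    [Limits.PreservesFilteredColimits (forget C)] [(forget C).ReflectsIsomorphisms]
    {X : TopCat.{u}} [DiscreteTopology X] (F : TopCat.Sheaf C X) :
    Function.Bijective fun (b : ToType (F.presheaf.obj (.op ⊤))) (x : X) =>
      F.presheaf.germ ⊤ x (Opens.mem_top x) b := by
  refine ⟨fun a b h => TopCat.Presheaf.section_ext F ⊤ a b fun x _ => congrFun h x, fun t => ?_⟩
  let U : X → Opens X := fun x => ⟨{x}, isOpen_discrete _⟩
  have hU : ∀ x, x ∈ U x := fun x => rfl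
  have exists_section : ∀ x, ∃ f, F.presheaf.germ (U x) x (hU x) f = t x := fun x => by
    obtain ⟨V, hV, f, hf⟩ := F.presheaf.exists_germ_eq (t x)
    have hle : U x ≤ V := by
      rintro _ rfl
      exact hV
    exact ⟨F.presheaf.map (homOfLE hle).op f,
      (F.presheaf.germ_res_apply (homOfLE hle) x (hU x) f).trans hf⟩
  choose f hf using exists_section
  have compatible : TopCat.Presheaf.IsCompatible F.presheaf U f := fun x y => by
    by_cases h : x = y
    · subst h
      rfl
    · refine TopCat.Presheaf.section_ext F _ _ _ ?_
      rintro z ⟨rfl, rfl⟩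
      exact (h rfl).elim
  obtain ⟨b, hb, -⟩ := F.existsUnique_gluing' U ⊤ (fun _ => homOfLE le_top)
    (fun x _ => Opens.mem_iSup.mpr ⟨x, hU x⟩) f compatible
  refine ⟨b, funext fun x => ?_⟩
  rw [← hf x, ← hb x]
  exact (F.presheaf.germ_res_apply (homOfLE le_top) x (hU x) b).symm

end Germs

noncomputable section Schemes

variable {k : Type u} [Field k]

instance (S : KScheme k) [IsFinite S.hom] : Module.Finite k (Sections S) :=
  Sections.finite S inferInstance

theorem Dist.exists_of {X : KScheme k} (d : Dist X) :
    ∃ (S : FiniteSub X) (φ : Module.Dual k (Sections S.scheme)), of S φ = d :=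
  CoalgLimit.exists_of (ι := FiniteSub X) (G := fun S => Module.Dual k (Sections S.scheme)) _ d

theorem Dist.hom_ext {X : KScheme k} {C : Type*} [AddCommGroup C] [Module k C] [Coalgebra k C]
    {p q : Dist X →ₗc[k] C}
    (h : ∀ (S : FiniteSub X) (φ : Module.Dual k (Sections S.scheme)), p (of S φ) = q (of S φ)) :
    p = q := by
  refine CoalgHom.ext fun d => ?_
  obtain ⟨S, φ, rfl⟩ := exists_of d
  exact h S φ

theorem FiniteSub.image_le {W X : KScheme k} [IsFinite W.hom] {g : W ⟶ X} {S : FiniteSub X}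
    {h : W ⟶ S.scheme} (hg : h ≫ S.ι = g) : image g ≤ S := by
  subst hg
  exact (Scheme.IdealSheafData.ker_subschemeι S.1).symm.le.trans
    (Scheme.Hom.le_ker_comp h.left S.ι.left)

theorem FiniteSub.toImage_incl {W X : KScheme k} [IsFinite W.hom] {g : W ⟶ X} {S : FiniteSub X}
    {h : W ⟶ S.scheme} (hg : h ≫ S.ι = g) : toImage g ≫ incl (image_le hg) = h :=
  hom_ext _ (by rw [Category.assoc, incl_ι, toImage_ι, hg])

theorem Dist.of_image {W X : KScheme k} [IsFinite W.hom]
    {g : W ⟶ X} {S : FiniteSub X} {h : W ⟶ S.scheme} (hg : h ≫ S.ι = g)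
    (φ : Module.Dual k (Sections W)) :
    of (FiniteSub.image g) (dualMap (Sections.map (FiniteSub.toImage g)) φ)
      = of S (dualMap (Sections.map h) φ) := by
  calc of (FiniteSub.image g) (dualMap (Sections.map (FiniteSub.toImage g)) φ)
      = of S (dualMap (Sections.map (FiniteSub.toImage g ≫ FiniteSub.incl (FiniteSub.image_le hg)))
          φ) := by
        rw [← of_incl (FiniteSub.image_le hg), Sections.map_comp]
        rfl
    _ = of S (dualMap (Sections.map h) φ) := by rw [FiniteSub.toImage_incl hg]

theorem Dist.map_comp {X Y Z : KScheme k} (f : X ⟶ Y) (g : Y ⟶ Z) :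
    map (f ≫ g) = (map g).comp (map f) := by
  refine hom_ext fun S φ => ?_
  let T := FiniteSub.image (S.ι ≫ f)
  let q : S.scheme ⟶ T.scheme := FiniteSub.toImage (S.ι ≫ f)
  have hq : (q ≫ FiniteSub.toImage (T.ι ≫ g)) ≫ (FiniteSub.image (T.ι ≫ g)).ι = S.ι ≫ f ≫ g := by
    rw [Category.assoc, FiniteSub.toImage_ι, ← Category.assoc, FiniteSub.toImage_ι, Category.assoc]
  rw [CoalgHom.comp_apply, map_of, map_of, map_of, of_image hq, Sections.map_comp]
  rfl

theorem Dist.map_ι {X : KScheme k} (S : FiniteSub X) (d : Dist S.scheme) :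
    map S.ι d = of S (FiniteDual.incl k _ (toFiniteDual S.scheme d)) := by
  obtain ⟨T, φ, rfl⟩ := exists_of d
  rw [map_of, of_image (g := T.ι ≫ S.ι) rfl, toFiniteDual_of]
  rfl

theorem Dist.toFiniteDual_map {X Y : KScheme k} (f : X ⟶ Y) (d : Dist X) :
    toFiniteDual Y (map f d) = FiniteDual.map (Sections.map f) (toFiniteDual X d) := by
  obtain ⟨S, φ, rfl⟩ := exists_of d
  have hcomp : (Sections.map (FiniteSub.toImage (S.ι ≫ f))).comp
      (Sections.map (FiniteSub.image (S.ι ≫ f)).ι) = (Sections.map S.ι).comp (Sections.map f) := by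
    rw [← Sections.map_comp, FiniteSub.toImage_ι, Sections.map_comp]
  rw [map_of, toFiniteDual_of, toFiniteDual_of]
  exact FiniteDual.ext fun a => congrArg φ (DFunLike.congr_fun hcomp a)

variable (k) in
/-- The morphism of `k`-schemes `Spec B ⟶ Spec A` induced by a homomorphism `A → B` of
`k`-algebras. -/
def specOver.map {A B : Type u} [CommRing A] [Algebra k A] [CommRing B] [Algebra k B]
    (f : A →ₐ[k] B) : specOver k B ⟶ specOver k A :=
  Over.homMk (Spec.map (CommRingCat.ofHom f.toRingHom)) (by
    change Spec.map _ ≫ Spec.map _ = Spec.map _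
    rw [← Spec.map_comp, ← CommRingCat.ofHom_comp]
    congr 2
    exact f.comp_algebraMap)

section Spec

variable {A B : Type u} [CommRing A] [Algebra k A] [CommRing B] [Algebra k B] (f : A →ₐ[k] B)

theorem sectionsSpecEquiv_naturality (a : A) :
    Sections.map (specOver.map k f) (sectionsSpecEquiv k A a) = sectionsSpecEquiv k B (f a) :=
  (congrArg (fun g => g.hom a)
    (Scheme.ΓSpecIso_inv_naturality (CommRingCat.ofHom f.toRingHom))).symm

theorem distSpecEquiv_apply (d : Dist (specOver k A)) :
    distSpecEquiv k A d =
      FiniteDual.map (sectionsSpecEquiv k A).toAlgHom (Dist.toFiniteDual (specOver k A) d) := rfl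

theorem distSpecEquiv_map (d : Dist (specOver k B)) :
    distSpecEquiv k A (Dist.map (specOver.map k f) d) =
      FiniteDual.map f (distSpecEquiv k B d) := by
  rw [distSpecEquiv_apply, distSpecEquiv_apply, Dist.toFiniteDual_map]
  exact FiniteDual.ext fun a =>
    congrArg (FiniteDual.incl k _ (Dist.toFiniteDual _ d)) (sectionsSpecEquiv_naturality f a)

end Spec

theorem LocalRing.map_fromSpec {X Y : KScheme k} (f : X ⟶ Y) (x : X.left) :
    specOver.map k (map f x) ≫ fromSpec Y (f.left x) = fromSpec X x ≫ f := by
  ext1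
  exact Scheme.SpecMap_stalkMap_fromSpecStalk f.left

theorem LocalRing.map_comp {X Y Z : KScheme k} (f : X ⟶ Y) (g : Y ⟶ Z) (x : X.left) :
    map (f ≫ g) x = (map f x).comp (map g (f.left x)) := by
  ext a
  exact congrArg (fun h => h.hom a) (Scheme.Hom.stalkMap_comp f.left g.left x)

theorem DistAt.toDist_distSpecEquiv (X : KScheme k) (x : X.left)
    (d : Dist (specOver k (LocalRing X x))) :
    toDist X x (distSpecEquiv k _ d) = Dist.map (LocalRing.fromSpec X x) d :=
  congrArg (Dist.map (LocalRing.fromSpec X x)) ((distSpecEquiv k _).symm_apply_apply d)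

theorem DistAt.toDist_map {X Y : KScheme k} (f : X ⟶ Y) (x : X.left) (ψ : DistAt X x) :
    toDist Y (f.left x) (FiniteDual.map (LocalRing.map f x) ψ) = Dist.map f (toDist X x ψ) := by
  obtain ⟨d, rfl⟩ := EquivLike.surjective (distSpecEquiv k (LocalRing X x)) ψ
  rw [← distSpecEquiv_map, toDist_distSpecEquiv, toDist_distSpecEquiv, ← CoalgHom.comp_apply,
    ← CoalgHom.comp_apply, ← Dist.map_comp, ← Dist.map_comp, LocalRing.map_fromSpec]

namespace DistSum

/-- The inclusion of the summand at the point `x` of `P`. -/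
def of (X : KScheme k) {P : Set X.left} {x : X.left} (hx : x ∈ P) : DistAt X x →ₗc[k] DistSum X P :=
  CoalgSum.of k (fun x : P => DistAt X x.1) ⟨x, hx⟩

theorem hom_ext {X : KScheme k} {P : Set X.left} {C : Type*} [AddCommGroup C] [Module k C]
    [Coalgebra k C] {p q : DistSum X P →ₗc[k] C}
    (h : ∀ (x : X.left) (hx : x ∈ P) (ψ : DistAt X x), p (of X hx ψ) = q (of X hx ψ)) : p = q :=
  CoalgSum.hom_ext fun x => h x.1 x.2

theorem toDist_of (X : KScheme k) {P : Set X.left} {x : X.left} (hx : x ∈ P) (ψ : DistAt X x) :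
    toDist X P (of X hx ψ) = DistAt.toDist X x ψ :=
  CoalgSum.lift_of (G := fun x : P => DistAt X x.1) _ ⟨x, hx⟩ ψ

theorem map_of {X Y : KScheme k} (f : X ⟶ Y) {x : X.left} (hx : x ∈ finPoints X)
    (ψ : DistAt X x) :
    map f (of X hx ψ) = of Y (map_mem_finPoints f hx) (FiniteDual.map (LocalRing.map f x) ψ) :=
  CoalgSum.lift_of (G := fun x : finPoints X => DistAt X x.1) _ ⟨x, hx⟩ ψ

theorem map_comp {X Y Z : KScheme k} (f : X ⟶ Y) (g : Y ⟶ Z) :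
    map (f ≫ g) = (map g).comp (map f) := by
  refine hom_ext fun x hx ψ => ?_
  rw [CoalgHom.comp_apply, map_of, map_of, map_of, LocalRing.map_comp]
  rfl

theorem toDist_naturality {X Y : KScheme k} (f : X ⟶ Y) :
    (toDist Y (finPoints Y)).comp (map f) = (Dist.map f).comp (toDist X (finPoints X)) := by
  refine hom_ext fun x hx ψ => ?_
  rw [CoalgHom.comp_apply, CoalgHom.comp_apply, map_of, toDist_of, toDist_of, DistAt.toDist_map]

end DistSum

/-- The homomorphism of `k`-algebras that takes the germ at a point of a global section. -/
def LocalRing.germ (X : KScheme k) (x : X.left) : Sections X →ₐ[k] LocalRing X x where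
  __ := (X.left.presheaf.germ ⊤ x (TopologicalSpace.Opens.mem_top x)).hom
  commutes' _ := rfl

theorem Sections.map_fromSpec (X : KScheme k) (x : X.left) (a : Sections X) :
    map (LocalRing.fromSpec X x) a = sectionsSpecEquiv k _ (LocalRing.germ X x a) := by
  refine (congrArg (fun g => g.hom a) (Scheme.fromSpecStalk_appTop (X := X.left) (x := x))).trans ?_
  exact congrArg (fun p => p.hom (sectionsSpecEquiv k (LocalRing X x)
      (LocalRing.germ X x a)))
    ((Spec (X.left.presheaf.stalk x)).presheaf.map_id (.op ⊤))

theorem DistAt.toFiniteDual_toDist (X : KScheme k) (x : X.left) (ψ : DistAt X x) :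
    Dist.toFiniteDual X (toDist X x ψ) = FiniteDual.map (LocalRing.germ X x) ψ := by
  obtain ⟨d, rfl⟩ := EquivLike.surjective (distSpecEquiv k (LocalRing X x)) ψ
  rw [toDist_distSpecEquiv, Dist.toFiniteDual_map]
  exact FiniteDual.ext fun a =>
    congrArg (FiniteDual.incl k _ (Dist.toFiniteDual _ d)) (Sections.map_fromSpec X x a)

theorem LocalRing.germ_bijective (S : KScheme k) [IsFinite S.hom] :
    Function.Bijective (AlgHom.pi fun s : S.left => germ S s) :=
  have := isArtinianScheme_of_isFinite S
  germ_bijective_of_discreteTopology S.left.sheaf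

theorem LocalRing.germ_surjective (S : KScheme k) [IsFinite S.hom] (s : S.left) :
    Function.Surjective (germ S s) :=
  (Function.surjective_eval s).comp (germ_bijective S).surjective

/-- The homomorphism of `k`-algebras `𝒪_{X,x} → κ(x)`. -/
def LocalRing.residue (X : KScheme k) (x : X.left) : LocalRing X x →ₐ[k] ResField X x where
  __ := (X.left.residue x).hom
  commutes' _ := rfl

theorem LocalRing.residue_surjective (X : KScheme k) (x : X.left) :
    Function.Surjective (residue X x) :=
  X.left.residue_surjective x

theorem mem_finPoints_of_isFinite (S : KScheme k) [IsFinite S.hom] (s : S.left) :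
    s ∈ finPoints S :=
  Module.Finite.of_surjective ((LocalRing.residue S s).comp (LocalRing.germ S s)).toLinearMap
    ((LocalRing.residue_surjective S s).comp (LocalRing.germ_surjective S s))

/-- The isomorphism `Γ(S, 𝒪_S) ≃ ∏ 𝒪_{S,s}` taking a section to its germs, for a finite `k`-scheme
`S`. The product is indexed by `finPoints S`, which is all of `S`, to match `DistSum`. -/
def sectionsEquivPi (S : KScheme k) [IsFinite S.hom] :
    Sections S ≃ₐ[k] ∀ s : finPoints S, LocalRing S s.1 :=
  let e : S.left ≃ finPoints S :=
    (Equiv.subtypeUnivEquiv (mem_finPoints_of_isFinite S)).symm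
  AlgEquiv.ofBijective (AlgHom.pi fun s : finPoints S => LocalRing.germ S s.1) <|
    (Equiv.piCongrLeft' (LocalRing S) e).bijective.comp (LocalRing.germ_bijective S)

theorem DistSum.toFiniteDual_toDist_bijective (S : KScheme k) [IsFinite S.hom] :
    Function.Bijective ((Dist.toFiniteDual S).comp (toDist S (finPoints S))) := by
  have := isArtinianScheme_of_isFinite S
  let A (s : finPoints S) := LocalRing S s.1
  have key : (Dist.toFiniteDual S).comp (toDist S (finPoints S)) =
      (FiniteDual.map (sectionsEquivPi S).toAlgHom).comp
        (CoalgSum.lift fun s => FiniteDual.map (Pi.evalAlgHom k A s)) := by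
    refine hom_ext fun s hs ψ => ?_
    rw [CoalgHom.comp_apply, toDist_of, DistAt.toFiniteDual_toDist, CoalgHom.comp_apply, of,
      CoalgSum.lift_of]
    rfl
  rw [key]
  exact (FiniteDual.map_bijective (sectionsEquivPi S)).comp (FiniteDual.lift_map_eval_bijective A)

/-- The decomposition of the dual coalgebra of a finite `k`-scheme according to its points. -/
def DistSum.finiteDualEquiv (S : KScheme k) [IsFinite S.hom] :
    DistSum S (finPoints S) ≃ₗc[k] FiniteDual k (Sections S) :=
  CoalgEquiv.ofBijective (toFiniteDual_toDist_bijective S)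

theorem DistSum.finiteDualEquiv_apply (S : KScheme k) [IsFinite S.hom]
    (d : DistSum S (finPoints S)) :
    finiteDualEquiv S d = Dist.toFiniteDual S (toDist S (finPoints S) d) := rfl

theorem DistSum.toFiniteDual_toDist_finiteDualEquiv_symm (S : KScheme k) [IsFinite S.hom]
    (φ : FiniteDual k (Sections S)) :
    Dist.toFiniteDual S (toDist S (finPoints S) ((finiteDualEquiv S).symm φ)) = φ :=
  (finiteDualEquiv S).apply_symm_apply φ

theorem DistSum.map_finiteDualEquiv_symm {S T : KScheme k} [IsFinite S.hom] [IsFinite T.hom]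
    (f : S ⟶ T) (φ : FiniteDual k (Sections S)) :
    map f ((finiteDualEquiv S).symm φ) =
      (finiteDualEquiv T).symm (FiniteDual.map (Sections.map f) φ) := by
  obtain ⟨d, rfl⟩ := EquivLike.surjective (finiteDualEquiv S) φ
  apply EquivLike.injective (finiteDualEquiv T)
  have naturality := CoalgHom.congr_fun (toDist_naturality f) d
  simp only [CoalgHom.comp_apply] at naturality
  rw [CoalgEquiv.symm_apply_apply, CoalgEquiv.apply_symm_apply, finiteDualEquiv_apply,
    finiteDualEquiv_apply, naturality, Dist.toFiniteDual_map]

/-- The homomorphism `Γ(W, 𝒪_W)^* → ⨁ Dist(X, x)` induced by a morphism `W ⟶ X` from a finite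
`k`-scheme, obtained by decomposing functionals on `W` according to the points of `W`. -/
def DistSum.ofDual {W X : KScheme k} [IsFinite W.hom] (g : W ⟶ X) :
    Module.Dual k (Sections W) →ₗc[k] DistSum X (finPoints X) :=
  (map g).comp <| (finiteDualEquiv W).symm.toCoalgHom.comp <|
    FiniteDual.ofDual (AlgHom.id k (Sections W))

section OfDual

variable {V W X : KScheme k} [IsFinite V.hom] [IsFinite W.hom]

theorem DistSum.ofDual_apply (g : W ⟶ X) (φ : Module.Dual k (Sections W)) :
    ofDual g φ = map g ((finiteDualEquiv W).symm (FiniteDual.ofDual (AlgHom.id k _) φ)) := rfl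

theorem DistSum.map_ofDual {Y : KScheme k} (f : X ⟶ Y) (g : W ⟶ X)
    (φ : Module.Dual k (Sections W)) : map f (ofDual g φ) = ofDual (g ≫ f) φ := by
  rw [ofDual_apply, ofDual_apply, map_comp, CoalgHom.comp_apply]

theorem DistSum.ofDual_dualMap (h : V ⟶ W) (g : W ⟶ X) (φ : Module.Dual k (Sections V)) :
    ofDual g (dualMap (Sections.map h) φ) = ofDual (h ≫ g) φ := by
  have hdual : FiniteDual.ofDual (AlgHom.id k _) (dualMap (Sections.map h) φ) =
      FiniteDual.map (Sections.map h) (FiniteDual.ofDual (AlgHom.id k _) φ) := rfl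
  rw [ofDual_apply, ofDual_apply, hdual, ← map_finiteDualEquiv_symm, map_comp, CoalgHom.comp_apply]

end OfDual

/-- The inverse of `DistSum.toDist X (finPoints X)`. -/
def Dist.toDistSum (X : KScheme k) : Dist X →ₗc[k] DistSum X (finPoints X) :=
  CoalgLimit.lift _ (fun S => DistSum.ofDual S.ι) fun S T h φ => by
    rw [DistSum.ofDual_dualMap, FiniteSub.incl_ι]

theorem Dist.toDistSum_of {X : KScheme k} (S : FiniteSub X)
    (φ : Module.Dual k (Sections S.scheme)) : toDistSum X (of S φ) = DistSum.ofDual S.ι φ :=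
  CoalgLimit.lift_of (ι := FiniteSub X) (G := fun S => Module.Dual k (Sections S.scheme)) _ _ _ S φ

theorem Dist.toDistSum_naturality {X Y : KScheme k} (f : X ⟶ Y) :
    (toDistSum Y).comp (map f) = (DistSum.map f).comp (toDistSum X) := by
  refine hom_ext fun S φ => ?_
  rw [CoalgHom.comp_apply, CoalgHom.comp_apply, map_of, toDistSum_of, toDistSum_of,
    DistSum.map_ofDual, DistSum.ofDual_dualMap, FiniteSub.toImage_ι]

theorem DistSum.toDist_toDistSum (X : KScheme k) (d : Dist X) :
    toDist X (finPoints X) (Dist.toDistSum X d) = d := by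
  obtain ⟨S, φ, rfl⟩ := Dist.exists_of d
  let ψ : FiniteDual k (Sections S.scheme) := FiniteDual.ofDual (AlgHom.id k _) φ
  calc toDist X (finPoints X) (Dist.toDistSum X (Dist.of S φ))
      = toDist X (finPoints X) (map S.ι ((finiteDualEquiv S.scheme).symm ψ)) := by
        rw [Dist.toDistSum_of, ofDual_apply]
    _ = Dist.map S.ι (toDist S.scheme _ ((finiteDualEquiv S.scheme).symm ψ)) :=
        CoalgHom.congr_fun (toDist_naturality S.ι) _
    _ = Dist.of S φ := by
        rw [Dist.map_ι, toFiniteDual_toDist_finiteDualEquiv_symm]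
        rfl

instance {X : KScheme k} (S : FiniteSub X) : IsClosedImmersion S.ι.left :=
  inferInstanceAs (IsClosedImmersion S.1.subschemeι)

theorem isClosed_singleton_of_isFinite {W X : KScheme k} [IsFinite W.hom] (g : W ⟶ X) (w : W.left) :
    IsClosed {g.left w} := by
  let S := FiniteSub.image g
  have := isArtinianScheme_of_isFinite S.scheme
  have hg : g.left w = S.ι.left ((FiniteSub.toImage g).left w) := by
    rw [← Scheme.Hom.comp_apply, ← Over.comp_left, FiniteSub.toImage_ι]
  rw [hg, ← Set.image_singleton]
  exact S.ι.left.isClosedEmbedding.isClosedMap _ (isClosed_discrete _)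

theorem finPoints_subset_closedPoints (X : KScheme k) : finPoints X ⊆ closedPoints X.left := by
  intro x hx
  let Z : KScheme k := Over.mk (X.left.fromSpecResidueField x ≫ X.hom)
  let g : Z ⟶ X := Over.homMk (X.left.fromSpecResidueField x) rfl
  have hZ : Z.hom = Spec.map (LocalRing.structureHom X x ≫ X.left.residue x) := by
    rw [Spec.map_comp, LocalRing.structureHom, Spec.map_comp, ← Scheme.fromSpecStalk_toSpecΓ_assoc,
      toSpecΓ_structureHom]
    rfl
  have : IsFinite Z.hom := hZ ▸ (IsFinite.SpecMap_iff _).mpr hx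
  let z : Spec (X.left.residueField x) := IsLocalRing.closedPoint _
  have hz : g.left z = x := X.left.fromSpecResidueField_apply x z
  exact mem_closedPoints_iff.mpr (hz ▸ isClosed_singleton_of_isFinite g z)

instance (X : KScheme k) (x : X.left) : IsLocalRing (LocalRing X x) :=
  inferInstanceAs (IsLocalRing (X.left.presheaf.stalk x))

theorem DistAt.subsingleton {X : KScheme k} {x : X.left} (hx : x ∉ finPoints X) :
    Subsingleton (DistAt X x) := by
  by_contra h
  have : Nontrivial (DistAt X x) := not_subsingleton_iff_nontrivial.mp h
  exact hx (FiniteDual.finite_of_surjective_of_isLocalRing (LocalRing.residue_surjective X x))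

theorem finPoints_specOver_subset (A : Type u) [CommRing A] [Algebra k A] [IsLocalRing A] :
    finPoints (specOver k A) ⊆ {IsLocalRing.closedPoint A} := fun p hp =>
  ((IsLocalRing.specializes_closedPoint p).mem_closed
    (mem_closedPoints_iff.mp (finPoints_subset_closedPoints _ hp)) rfl).symm

theorem DistSum.of_eq_of {X : KScheme k} {P : Set X.left} {x y : X.left} (hx : x ∈ P) (hy : y ∈ P)
    (hxy : x = y) {φ : DistAt X x} {ψ : DistAt X y}
    (h : ∀ (U : X.left.Opens) (hxU : x ∈ U) (hyU : y ∈ U) (f : Γ(X.left, U)),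
      FiniteDual.incl k _ φ (X.left.presheaf.germ U x hxU f) =
        FiniteDual.incl k _ ψ (X.left.presheaf.germ U y hyU f)) :
    of X hx φ = of X hy ψ := by
  subst hxy
  refine congrArg (of X hx) (FiniteDual.ext fun a => ?_)
  obtain ⟨U, hU, f, rfl⟩ := X.left.presheaf.exists_germ_eq a
  exact h U hU hU f

theorem LocalRing.map_fromSpec_germ (X : KScheme k) (x : X.left)
    (p : (specOver k (LocalRing X x)).left) {U : X.left.Opens} (hx : x ∈ U)
    (hp : (fromSpec X x).left p ∈ U) (f : Γ(X.left, U)) :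
    map (fromSpec X x) p (X.left.presheaf.germ U _ hp f) =
      germ _ p (sectionsSpecEquiv k (LocalRing X x) (X.left.presheaf.germ U x hx f)) := by
  let Z := Spec (X.left.presheaf.stalk x)
  refine (Scheme.Hom.germ_stalkMap_apply (X.left.fromSpecStalk x) U p hp f).trans ?_
  have h := congrArg (fun g => g.hom f) (Scheme.fromSpecStalk_app (X := X.left) hx)
  refine (congrArg (Z.presheaf.germ (X.left.fromSpecStalk x ⁻¹ᵁ U) p hp) h).trans ?_
  exact Z.presheaf.germ_res_apply (homOfLE le_top) p hp _

theorem DistSum.map_fromSpec (X : KScheme k) {x : X.left} (hx : x ∈ finPoints X)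
    (d : DistSum (specOver k (LocalRing X x)) (finPoints _)) :
    map (LocalRing.fromSpec X x) d = of X hx (distSpecEquiv k _ (toDist _ _ d)) := by
  let A := LocalRing X x
  suffices h : map (LocalRing.fromSpec X x) =
      (of X hx).comp ((distSpecEquiv k A).toCoalgHom.comp (toDist (specOver k A) _)) from
    CoalgHom.congr_fun h d
  refine hom_ext fun p hp ψ => ?_
  have hpx : (LocalRing.fromSpec X x).left p = x := by
    rw [finPoints_specOver_subset A hp]
    exact Scheme.fromSpecStalk_closedPoint
  have hψ : distSpecEquiv k A (toDist _ _ (of _ hp ψ)) = FiniteDual.map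
      (sectionsSpecEquiv k A).toAlgHom (FiniteDual.map (LocalRing.germ _ p) ψ) := by
    rw [toDist_of, distSpecEquiv_apply, DistAt.toFiniteDual_toDist]
  rw [map_of]
  refine (of_eq_of _ hx hpx fun U hpU hxU f => ?_).trans (congrArg (of X hx) hψ.symm)
  exact congrArg (FiniteDual.incl k _ ψ) (LocalRing.map_fromSpec_germ X x p hxU hpU f)

theorem DistSum.toDistSum_toDist (X : KScheme k) (d : DistSum X (finPoints X)) :
    Dist.toDistSum X (toDist X _ d) = d := by
  suffices h : (Dist.toDistSum X).comp (toDist X _) = CoalgHom.id k _ from CoalgHom.congr_fun h d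
  refine hom_ext fun x hx ψ => ?_
  obtain ⟨d, rfl⟩ := EquivLike.surjective (distSpecEquiv k (LocalRing X x)) ψ
  calc Dist.toDistSum X (toDist X _ (of X hx (distSpecEquiv k _ d)))
      = Dist.toDistSum X (Dist.map (LocalRing.fromSpec X x) d) := by
        rw [toDist_of, DistAt.toDist_distSpecEquiv]
    _ = map (LocalRing.fromSpec X x) (Dist.toDistSum _ d) :=
        CoalgHom.congr_fun (Dist.toDistSum_naturality (LocalRing.fromSpec X x)) d
    _ = of X hx (distSpecEquiv k _ d) := by rw [map_fromSpec, toDist_toDistSum]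

theorem DistSum.toDist_finPoints_bijective (X : KScheme k) :
    Function.Bijective (toDist X (finPoints X)) :=
  Function.bijective_iff_has_inverse.mpr
    ⟨Dist.toDistSum X, toDistSum_toDist X, toDist_toDistSum X⟩

/-- The inclusion `⨁_{x ∈ P} Dist(X, x) → ⨁_{x ∈ Q} Dist(X, x)` for `P ⊆ Q`. -/
def DistSum.inclusion (X : KScheme k) {P Q : Set X.left} (h : P ⊆ Q) :
    DistSum X P →ₗc[k] DistSum X Q :=
  CoalgSum.lift fun x : P => of X (h x.2)

theorem DistSum.inclusion_of (X : KScheme k) {P Q : Set X.left} (h : P ⊆ Q) {x : X.left}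
    (hx : x ∈ P) (ψ : DistAt X x) : inclusion X h (of X hx ψ) = of X (h hx) ψ :=
  CoalgSum.lift_of (G := fun x : P => DistAt X x.1) _ ⟨x, hx⟩ ψ

theorem DistSum.toDist_comp_inclusion (X : KScheme k) {P Q : Set X.left} (h : P ⊆ Q) :
    (toDist X Q).comp (inclusion X h) = toDist X P :=
  hom_ext fun x hx ψ => by rw [CoalgHom.comp_apply, inclusion_of, toDist_of, toDist_of]

theorem DistSum.inclusion_surjective (X : KScheme k) {P : Set X.left} (h : finPoints X ⊆ P) :
    Function.Surjective (inclusion X h) := by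
  refine LinearMap.range_eq_top (f := (inclusion X h).toLinearMap) |>.mp <|
    CoalgSum.eq_top_of_forall_of_mem fun x ψ => ?_
  by_cases hx : x.1 ∈ finPoints X
  · exact ⟨of X hx ψ, inclusion_of X h hx ψ⟩
  · have := DistAt.subsingleton hx
    rw [Subsingleton.elim ψ 0, map_zero]
    exact zero_mem _

theorem DistSum.toDist_bijective (X : KScheme k) {P : Set X.left} (h : finPoints X ⊆ P) :
    Function.Bijective (toDist X P) := by
  have hcomp : toDist X P ∘ inclusion X h = toDist X (finPoints X) :=
    congrArg DFunLike.coe (toDist_comp_inclusion X h)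
  have hbij : Function.Bijective (toDist X P ∘ inclusion X h) :=
    hcomp ▸ toDist_finPoints_bijective X
  exact ⟨hbij.injective.of_comp_right (inclusion_surjective X h), hbij.surjective.of_comp⟩

end Schemes

end SchemeDist

theorem mainTheorem12 (k : Type u) [Field k] :
    ∃ e : ∀ X : KScheme k, DistSum X (finPoints X) ≃ₗc[k] Dist X,
      (∀ X : KScheme k, (e X).toCoalgHom = DistSum.toDist X (finPoints X)) ∧
      (∀ (X Y : KScheme k) (f : X ⟶ Y),
        (e Y).toCoalgHom.comp (DistSum.map f) = (Dist.map f).comp (e X).toCoalgHom) ∧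
      (∀ X : KScheme k, finPoints X ⊆ closedPoints X.left) ∧
      (∀ (X : KScheme k) (x : X.left), x ∉ finPoints X → Subsingleton (DistAt X x)) ∧
      (∀ X : KScheme k, Function.Bijective (DistSum.toDist X (closedPoints X.left))) := by
  refine ⟨fun X => CoalgEquiv.ofBijective (DistSum.toDist_finPoints_bijective X), fun X => rfl,
    fun X Y f => DistSum.toDist_naturality f, finPoints_subset_closedPoints,
    fun X x => DistAt.subsingleton, fun X => ?_⟩
  exact DistSum.toDist_bijective X (finPoints_subset_closedPoints X)
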